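/- Let $q\ge 1$ and let $\Omega_q=\{x\in\mathbb R^{q+1}: x'x=1\}$ carry its uniform probability distribution $\nu_q$. For $x\in[-1,1]$ let $$F_q(x)=\mathrm B\!\left(\tfrac12,\tfrac q2\right)^{-1}\int_{-1}^x(1-s^2)^{q/2-1}\,ds,\qquad \mathrm B(a,b)=\frac{\Gamma(a)\Gamma(b)}{\Gamma(a+b)},$$ the cdf of $\gamma'x_0$ for $\gamma\sim\nu_q$ and any fixed $x_0\in\Omega_q$, and let $F_q^{-1}:[0,1]\to[-1,1]$ be its inverse. Let $n\ge1$, $X_1,\dots,X_n\in\Omega_q$, $\theta_{ij}=\cos^{-1}(X_i'X_j)\in[0,\pi]$, and $F_{n,\gamma}(x)=\frac1n\#\{i:\gamma'X_i\le x\}$. For a probability measure $W$ on $[0,1]$, identified with its cdf, let $dW(F_q(x))$ be the probability measure on $[-1,1]$ with cdf $x\mapsto W(F_q(x))$, and put $$P_{n,q}^{W}=n\int_{\Omega_q}\int_{-1}^{1}\bigl(F_{n,\gamma}(x)-F_q(x)\bigr)^2\,dW(F_q(x))\,\nu_q(d\gamma),\qquad \psi_q^{W}(\theta)=\int_{-1}^1A(\theta,x)\,dW(F_q(x)),$$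 where $A(\theta,x)=\nu_q\{\gamma:\gamma'u\le x,\ \gamma'v\le x\}$ for $u,v\in\Omega_q$ at angle $\cos^{-1}(u'v)=\theta\in[0,\pi]$; this quantity depends on $(u,v)$ only through $\theta$. Let $t\in(0,1)$, $t_m=\min(t,1-t)$, let $W_t(x)=\frac12\left(1_{\{t_m\le x\}}+1_{\{1-t_m\le x\}}\right)$, and write $P_{n,q}^{\mathrm R_t}$, $\psi_q^{\mathrm R_t}$ for $P_{n,q}^{W_t}$, $\psi_q^{W_t}$. Let $h_t(\theta)=\left(t_m-\frac{\theta}{2\pi}\right)_+-t_m^2$ and, for each $q$, $\theta_{t_m}=2\cos^{-1}\left(F_q^{-1}(1-t_m)\right)$. Then, for all $q\ge1$, $n\ge1$ and $X_1,\dots,X_n\in\Omega_q$, $$P_{n,q}^{\mathrm R_t}=\frac2n\sum_{i<j}\psi_q^{\mathrm R_t}(\theta_{ij})+\frac{1-n}2+nt(1-t),$$ where, for $\theta\in[0,\pi]$, the kernel satisfies the following. 1. For $q=1$, $\psi_1^{\mathrm R_t}(\theta)=h_t(\theta)+\frac12-t(1-t)$. 2. For all $q\ge2$ and $\theta\ge\theta_{t_m}$,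 $\psi_q^{\mathrm R_t}(\theta)=\frac12-t_m$. 3. For $q=2$ and $\theta<\theta_{t_m}$, $$\psi_2^{\mathrm R_t}(\theta)=-t_m+\frac12-\frac{1-2t_m}{\pi}\cos^{-1}\!\left(\frac{(\frac12-t_m)\tan(\theta/2)}{(t_m(1-t_m))^{1/2}}\right)+\frac1\pi\tan^{-1}\!\left(\frac{\left(\cos^2(\theta/2)-(1-2t_m)^2\right)^{1/2}}{\sin(\theta/2)}\right),$$ where the last arctangent is read as $\pi/2$ at $\theta=0$. 4. For $q=3$ and $\theta<\theta_{t_m}$, $$\psi_3^{\mathrm R_t}(\theta)=\frac12+t_m-\frac{\theta+\theta_{t_m}}{2\pi}+\frac1\pi\left\{\frac{\sin(\theta_{t_m})}2+\tan\!\left(\tfrac\theta2\right)\cos^2\!\left(\tfrac{\theta_{t_m}}2\right)\right\}.$$ 5. For all $q\ge2$ and $\theta<\theta_{t_m}$, $$\psi_q^{\mathrm R_t}(\theta)=t_m-\frac{\theta}{2\pi}+2\int_0^{\cos(\theta_{t_m}/2)}F_{q-1}\!\left(\frac{u\tan(\theta/2)}{(1-u^2)^{1/2}}\right)dF_q(u).$$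 Finally, for $q=1$ and $X_i=(\cos\Theta_i,\sin\Theta_i)$ with $\Theta_i\in\mathbb R$, $P_{n,1}^{\mathrm R_t}$ equals Rothman's statistic $$R_{n,t}=\frac1{2\pi n}\int_0^{2\pi}\bigl(N(\alpha,t)-nt\bigr)^2\,d\alpha,\qquad N(\alpha,t)=\#\{i:\cos^{-1}(\cos(\Theta_i-(\alpha+t\pi)))<t\pi\}.$$ -/

import Mathlib

open MeasureTheory Set

noncomputable section

/-- The unit hypersphere `Ω_q` of `ℝ^{q+1}`. -/
abbrev Hypersphere (q : ℕ) : Type :=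
  Metric.sphere (0 : EuclideanSpace ℝ (Fin (q + 1))) 1

/-- The uniform distribution `ν_q` on `Ω_q`: surface measure divided by the surface area. -/
def uniformSphere (q : ℕ) : Measure (Hypersphere q) :=
  ((volume : Measure (EuclideanSpace ℝ (Fin (q + 1)))).toSphere univ)⁻¹ •
    (volume : Measure (EuclideanSpace ℝ (Fin (q + 1)))).toSphere

/-- The scalar product `γ'x` of two points of `Ω_q`. -/
def dotSphere {q : ℕ} (γ x : Hypersphere q) : ℝ :=
  inner ℝ (γ : EuclideanSpace ℝ (Fin (q + 1))) (x : EuclideanSpace ℝ (Fin (q + 1)))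

/-- The angle `θ = arccos (x'y) ∈ [0, π]` between two points of `Ω_q`. -/
def angleSphere {q : ℕ} (x y : Hypersphere q) : ℝ :=
  Real.arccos (dotSphere x y)

/-- The density `B(1/2, q/2)⁻¹ (1 - s²)^{q/2 - 1}`, `s ∈ [-1, 1]`, of the projected uniform
distribution. -/
def projDensity (q : ℕ) (s : ℝ) : ℝ :=
  (ProbabilityTheory.beta (1 / 2) ((q : ℝ) / 2))⁻¹ * (1 - s ^ 2) ^ ((q : ℝ) / 2 - 1)

/-- The cdf `F_q` of the projected uniform distribution; it is `0` to the left of `-1` and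
constant to the right of `1`. -/
def projCdf (q : ℕ) (x : ℝ) : ℝ :=
  ∫ s in (-1)..(max (-1) (min x 1)), projDensity q s

/-- The inverse `F_q⁻¹ : [0, 1] → [-1, 1]` of `F_q` restricted to `[-1, 1]`. -/
def projQuantile (q : ℕ) : ℝ → ℝ :=
  Function.invFunOn (projCdf q) (Icc (-1) 1)

/-- The measure `dW(F_q(x))` on `[-1, 1]`, whose cdf is `x ↦ W([0, F_q(x)])`, for a measure `W`
carried by `[0, 1]`: the image of `W` under `F_q⁻¹`. -/
def projWeight (q : ℕ) (W : Measure ℝ) : Measure ℝ :=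
  W.map (projQuantile q)

/-- The empirical cdf `F_{n,γ}` of the projections `γ'X_1, …, γ'X_n`. -/
def projEcdf {q n : ℕ} (X : Fin n → Hypersphere q) (γ : Hypersphere q) (x : ℝ) : ℝ :=
  (Nat.card {i : Fin n // dotSphere γ (X i) ≤ x} : ℝ) / n

/-- The projected-ecdf statistic
`P_{n,q}^W = n E_γ[∫_{[-1,1]} (F_{n,γ}(x) - F_q(x))² dW(F_q(x))]`, `γ ∼ ν_q`. -/
def projStat {q n : ℕ} (W : Measure ℝ) (X : Fin n → Hypersphere q) : ℝ :=
  n * ∫ γ, (∫ x in Icc (-1 : ℝ) 1, (projEcdf X γ x - projCdf q x) ^ 2 ∂(projWeight q W))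
    ∂(uniformSphere q)

/-- `∫ 1{γ'u ≤ x, γ'v ≤ x} dν_q(γ)`, the proportion of `Ω_q` covered by the intersection of two
hyperspherical caps. -/
def capOverlap {q : ℕ} (u v : Hypersphere q) (x : ℝ) : ℝ :=
  (uniformSphere q).real {γ | dotSphere γ u ≤ x ∧ dotSphere γ v ≤ x}

/-- The point `cos θ e₀ + sin θ e_q` of `Ω_q`, for `q ≥ 1`; for `q = 0` (not a sphere under
consideration) it is `e₀`. -/
def arcPoint (q : ℕ) (θ : ℝ) : Hypersphere q :=
  if h : q = 0 then ⟨EuclideanSpace.single 0 1, by simp⟩ else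
  ⟨Real.cos θ • EuclideanSpace.single 0 1 + Real.sin θ • EuclideanSpace.single (Fin.last q) 1, by
    have h0 : Fin.last q ≠ 0 := fun e => h (by simpa using congrArg Fin.val e)
    rw [mem_sphere_zero_iff_norm, EuclideanSpace.norm_eq, Real.sqrt_eq_one,
      Fintype.sum_eq_add (0 : Fin (q + 1)) (Fin.last q) h0.symm]
    · simp [h0, h0.symm]
    · rintro i ⟨hi, hi'⟩
      simp [hi, hi']⟩

/-- `A(θ, x)`: the common value of `capOverlap u v x` for pairs `u, v` at angle `θ ∈ [0, π]`,
computed at the pair `e₀`, `cos θ e₀ + sin θ e_q`. -/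
def capOverlapAngle (q : ℕ) (θ x : ℝ) : ℝ :=
  capOverlap (arcPoint q 0) (arcPoint q θ) x

/-- The kernel `ψ_q^W(θ) = ∫_{[-1,1]} A(θ, x) dW(F_q(x))`. -/
def projKernel (q : ℕ) (W : Measure ℝ) (θ : ℝ) : ℝ :=
  ∫ x in Icc (-1 : ℝ) 1, capOverlapAngle q θ x ∂(projWeight q W)

/-- `t_m = min(t, 1 - t)`. -/
def tMin (t : ℝ) : ℝ := min t (1 - t)

/-- The probability measure `W_t`, of mass `1/2` at each of `t_m` and `1 - t_m`
(of mass `1` at `1/2` if `t = 1/2`). -/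
def rothmanWeight (t : ℝ) : Measure ℝ :=
  (2⁻¹ : ENNReal) • (Measure.dirac (tMin t) + Measure.dirac (1 - tMin t))

/-- The cdf of `W_t` is `x ↦ (1{t_m ≤ x} + 1{1 - t_m ≤ x}) / 2`. -/
theorem rothmanWeight_Iic (t x : ℝ) :
    (rothmanWeight t).real (Iic x) =
      1 / 2 * ((if tMin t ≤ x then 1 else 0) + (if 1 - tMin t ≤ x then 1 else 0)) := by
  by_cases h1 : tMin t ≤ x <;> by_cases h2 : 1 - tMin t ≤ x <;>
    simp [rothmanWeight, Measure.real, h1, h2, Set.indicator, ENNReal.inv_two_add_inv_two] <;> norm_num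

/-- `h_t(θ) = (t_m - θ/(2π))₊ - t_m²`. -/
def rothmanH (t θ : ℝ) : ℝ :=
  max (tMin t - θ / (2 * Real.pi)) 0 - tMin t ^ 2

/-- `θ_{t_m} = 2 arccos (F_q⁻¹(1 - t_m))`. -/
def thresholdAngle (q : ℕ) (t : ℝ) : ℝ :=
  2 * Real.arccos (projQuantile q (1 - tMin t))

/-- `N(α, t)`, the number of the angles `Θ_1, …, Θ_n` in the arc of length `2πt` with
midpoint `α + tπ`. -/
def arcCount {n : ℕ} (Θ : Fin n → ℝ) (α t : ℝ) : ℕ :=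
  Nat.card {i : Fin n // Real.arccos (Real.cos (Θ i - (α + t * Real.pi))) < t * Real.pi}

/-- Rothman's statistic `R_{n,t} = (2πn)⁻¹ ∫_0^{2π} (N(α, t) - n t)² dα` of a circular sample. -/
def rothmanStat {n : ℕ} (Θ : Fin n → ℝ) (t : ℝ) : ℝ :=
  1 / (2 * Real.pi * n) * ∫ α in (0 : ℝ)..(2 * Real.pi), ((arcCount Θ α t : ℝ) - n * t) ^ 2

end

/-! Write c for the quantile of order 1 - t_m; it is nonnegative. Since F_q is symmetric, the weight
is half a unit mass at each of c and -c, and inclusion-exclusion together with the antipodal map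
gives ψ(θ) = 1/2 - t_m + T(θ, c), where T(θ, c) is the measure of the intersection of the open caps
of height c about two points at angle θ (`capTail`, `projKernel_rothmanWeight`). Everything about
the kernel is therefore a computation of T.

If cos(θ/2) ≤ c the caps are disjoint (`capTail_eq_zero`). On the circle T is the length of an arc
(`capTail_one`). For q ≥ 2, start from two hemispheres, T(θ, 0) = 1/2 - θ/(2π) (`capTail_zero`), and
remove the set where the smaller of the two projections lies in (0, c]. The reflection exchanging
the two points halves that set, and slicing one half by the smaller projection expresses it through
F_{q-1} (`uniformSphere_wedge`, `capTail_sub`). This is the integral formula; for q = 2 and q = 3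
the integral is elementary.

The U-statistic form comes from expanding the square: products of two indicators integrate to
A(θ_ij, x). For Rothman's statistic, the atoms c and -c contribute equally, one of them is cos(πt),
and an arc count is the complement of a count of small projections.

The geometric inputs are invariance under isometries and the slicing formula
`lintegral_uniformSphere_slice`. Both come from Lebesgue measure on the ball, applied to functions
of the direction x/‖x‖. -/

noncomputable section

/-! ### Surface integrals as ball integrals of functions of the direction. -/

/-- Polar coordinates in Euclidean space. -/
theorem lintegral_euclidean_polar (p : ℕ) {h : EuclideanSpace ℝ (Fin (p + 1)) → ENNReal}
    (hh : Measurable h) :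
    ∫⁻ x, h x = ∫⁻ ξ : Hypersphere p, (∫⁻ r in Ioi (0 : ℝ), ENNReal.ofReal (r ^ p) *
      h (r • (ξ : EuclideanSpace ℝ (Fin (p + 1)))))
      ∂(volume : Measure (EuclideanSpace ℝ (Fin (p + 1)))).toSphere := by
  have hmp := Measure.measurePreserving_homeomorphUnitSphereProd
    (volume : Measure (EuclideanSpace ℝ (Fin (p + 1))))
  rw [finrank_euclideanSpace_fin, Nat.add_sub_cancel] at hmp
  have h1 : ∫⁻ x, h x = ∫⁻ x : ({0}ᶜ : Set (EuclideanSpace ℝ (Fin (p + 1)))), h x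
      ∂(Measure.comap Subtype.val volume) := by
    rw [lintegral_subtype_comap (measurableSet_singleton _).compl h, restrict_compl_singleton]
  have h2 : ∀ x : ({0}ᶜ : Set (EuclideanSpace ℝ (Fin (p + 1)))),
      h x = (fun z : Hypersphere p × Ioi (0 : ℝ) =>
        h ((z.2 : ℝ) • (z.1 : EuclideanSpace ℝ (Fin (p + 1)))))
        (homeomorphUnitSphereProd (EuclideanSpace ℝ (Fin (p + 1))) x) := by
    intro x
    have hx : ‖(x : EuclideanSpace ℝ (Fin (p + 1)))‖ ≠ 0 := norm_ne_zero_iff.2 x.2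
    simp [smul_smul, hx]
  have hm : Measurable (fun z : Hypersphere p × Ioi (0 : ℝ) =>
        h ((z.2 : ℝ) • (z.1 : EuclideanSpace ℝ (Fin (p + 1))))) := by fun_prop
  rw [h1, lintegral_congr h2, hmp.lintegral_comp hm, lintegral_prod _ hm.aemeasurable]
  refine lintegral_congr fun ξ => ?_
  rw [Measure.volumeIoiPow, lintegral_withDensity_eq_lintegral_mul _ (by fun_prop) (by fun_prop)]
  exact lintegral_subtype_comap measurableSet_Ioi
    (fun r : ℝ => ENNReal.ofReal (r ^ p) * h (r • (ξ : EuclideanSpace ℝ (Fin (p + 1)))))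

theorem lintegral_ofReal_pow_Ioo (p : ℕ) {w : ℝ} (hw : 0 ≤ w) :
    ∫⁻ r in Ioo 0 w, ENNReal.ofReal (r ^ p) = ENNReal.ofReal (w ^ (p + 1) / (p + 1)) := by
  rw [Measure.restrict_congr_set Ioo_ae_eq_Ioc, ← ofReal_integral_eq_lintegral_ofReal
    (intervalIntegral.intervalIntegrable_pow _).1, ← intervalIntegral.integral_of_le hw]
  · simp
  · filter_upwards [ae_restrict_mem measurableSet_Ioc] with y hy
    exact pow_nonneg hy.1.le _

/-- The integrand is constant along rays, so the radius contributes only ∫ r^p dr over (0, 1). This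
moves questions about the surface measure to Lebesgue measure on the ball. -/
theorem lintegral_ball_normalize (p : ℕ) {f : EuclideanSpace ℝ (Fin (p + 1)) → ENNReal}
    (hf : Measurable f) :
    ∫⁻ x in Metric.ball (0 : EuclideanSpace ℝ (Fin (p + 1))) 1, f (‖x‖⁻¹ • x) =
      ENNReal.ofReal (1 / (p + 1)) * ∫⁻ ξ : Hypersphere p, f ξ
        ∂(volume : Measure (EuclideanSpace ℝ (Fin (p + 1)))).toSphere := by
  rw [← lintegral_indicator measurableSet_ball, lintegral_euclidean_polar,
    ← lintegral_const_mul _ (by fun_prop)]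
  · refine lintegral_congr fun ξ => ?_
    have hξ : ‖(ξ : EuclideanSpace ℝ (Fin (p + 1)))‖ = 1 := by simp
    have : ∀ r ∈ Ioi (0 : ℝ), ENNReal.ofReal (r ^ p) * (Metric.ball 0 1).indicator
        (fun x => f (‖x‖⁻¹ • x)) (r • (ξ : EuclideanSpace ℝ (Fin (p + 1)))) =
        (Iio 1).indicator (fun r => ENNReal.ofReal (r ^ p) * f ξ) r := by
      intro r hr
      have hr : 0 < r := hr
      have hn : ‖r • (ξ : EuclideanSpace ℝ (Fin (p + 1)))‖ = r := by
        rw [norm_smul, hξ, Real.norm_of_nonneg hr.le, mul_one]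
      by_cases h1 : r < 1
      · rw [indicator_of_mem (by simpa [hn] using h1), indicator_of_mem (by simpa using h1), hn,
          smul_smul, inv_mul_cancel₀ hr.ne', one_smul]
      · rw [indicator_of_notMem (by simpa [hn] using h1), indicator_of_notMem (by simpa using h1),
          mul_zero]
    rw [setLIntegral_congr_fun measurableSet_Ioi this, lintegral_indicator measurableSet_Iio,
      Measure.restrict_restrict measurableSet_Iio, Iio_inter_Ioi, lintegral_mul_const _ (by fun_prop),
      lintegral_ofReal_pow_Ioo p zero_le_one]
    simp
  · exact Measurable.indicator (by fun_prop) measurableSet_ball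

theorem toSphere_univ_ne_zero (q : ℕ) :
    (volume : Measure (EuclideanSpace ℝ (Fin (q + 1)))).toSphere univ ≠ 0 := by
  rw [Ne, Measure.measure_univ_eq_zero]
  exact Measure.toSphere_ne_zero _

instance (q : ℕ) : IsProbabilityMeasure (uniformSphere q) :=
  ⟨by
    rw [uniformSphere, Measure.smul_apply, smul_eq_mul]
    exact ENNReal.inv_mul_cancel (toSphere_univ_ne_zero q) (measure_ne_top _ _)⟩

theorem toSphere_univ_euclidean (q : ℕ) :
    (volume : Measure (EuclideanSpace ℝ (Fin (q + 1)))).toSphere univ =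
      ENNReal.ofReal (2 * √Real.pi ^ (q + 1) / Real.Gamma ((q + 1) / 2)) := by
  have h0 : (0 : ℝ) < ((q : ℝ) + 1) / 2 := by positivity
  rw [Measure.toSphere_apply_univ, EuclideanSpace.volume_ball, finrank_euclideanSpace_fin,
    ← ENNReal.ofReal_natCast, ENNReal.ofReal_one, one_pow, one_mul,
    ← ENNReal.ofReal_mul (by positivity)]
  congr 1
  simp only [Fintype.card_fin, Nat.cast_add, Nat.cast_one]
  rw [Real.Gamma_add_one h0.ne']
  have := Real.Gamma_pos_of_pos h0
  field_simp

theorem lintegral_uniformSphere (p : ℕ) {f : EuclideanSpace ℝ (Fin (p + 1)) → ENNReal}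
    (hf : Measurable f) :
    ∫⁻ ξ, f ξ ∂(uniformSphere p) =
      ((volume : Measure (EuclideanSpace ℝ (Fin (p + 1)))).toSphere univ)⁻¹ * (ENNReal.ofReal (p + 1) *
      ∫⁻ x in Metric.ball (0 : EuclideanSpace ℝ (Fin (p + 1))) 1, f (‖x‖⁻¹ • x)) := by
  rw [lintegral_ball_normalize p hf, ← mul_assoc (ENNReal.ofReal (p + 1)),
    ← ENNReal.ofReal_mul (by positivity), mul_one_div_cancel (by positivity), ENNReal.ofReal_one,
    one_mul, uniformSphere, lintegral_smul_measure, smul_eq_mul]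

/-! ### Slicing the sphere by one coordinate. -/

/-- The vector with first coordinate `a` and remaining coordinates `y`. -/
def euclideanCons {n : ℕ} (a : ℝ) (y : EuclideanSpace ℝ (Fin n)) : EuclideanSpace ℝ (Fin (n + 1)) :=
  WithLp.toLp 2 (Fin.cons a y)

theorem measurable_euclideanCons {n : ℕ} :
    Measurable fun z : ℝ × EuclideanSpace ℝ (Fin n) => euclideanCons z.1 z.2 := by
  refine (WithLp.measurable_toLp 2 _).comp (measurable_pi_lambda _ fun i => ?_)
  refine Fin.cases ?_ (fun i => ?_) i
  · simpa using measurable_fst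
  · simp only [Fin.cons_succ]; fun_prop

theorem inner_euclideanCons {n : ℕ} (a b : ℝ) (y z : EuclideanSpace ℝ (Fin n)) :
    inner ℝ (euclideanCons a y) (euclideanCons b z) = a * b + inner ℝ y z := by
  simp [euclideanCons, PiLp.inner_apply, Fin.sum_univ_succ, mul_comm]

theorem smul_euclideanCons {n : ℕ} (r a : ℝ) (y : EuclideanSpace ℝ (Fin n)) :
    r • euclideanCons a y = euclideanCons (r * a) (r • y) := by
  ext i; refine Fin.cases ?_ (fun i => ?_) i <;> simp [euclideanCons]

theorem norm_euclideanCons_sq {n : ℕ} (a : ℝ) (y : EuclideanSpace ℝ (Fin n)) :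
    ‖euclideanCons a y‖ ^ 2 = a ^ 2 + ‖y‖ ^ 2 := by
  rw [← real_inner_self_eq_norm_sq, inner_euclideanCons, real_inner_self_eq_norm_sq]; ring

theorem lintegral_euclideanCons {n : ℕ} {h : EuclideanSpace ℝ (Fin (n + 1)) → ENNReal}
    (hh : Measurable h) : ∫⁻ x, h x = ∫⁻ y, ∫⁻ a, h (euclideanCons a y) := by
  have h1 := (PiLp.volume_preserving_toLp (Fin (n + 1))).lintegral_comp hh
  have h2 := (volume_preserving_piFinSuccAbove (fun _ : Fin (n + 1) => ℝ) 0).symm.lintegral_comp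
    (hh.comp (WithLp.measurable_toLp 2 _))
  have h3 := (PiLp.volume_preserving_toLp (Fin n)).lintegral_comp
    (f := fun y => ∫⁻ a, h (euclideanCons a y))
    (Measurable.lintegral_prod_left (hh.comp measurable_euclideanCons))
  rw [← h1, ← h3]
  simp only [Function.comp_apply] at h2
  rw [← h2, Measure.volume_eq_prod, lintegral_prod_symm]
  · simp [MeasurableEquiv.piFinSuccAbove, Fin.insertNthEquiv, euclideanCons]
  · exact ((hh.comp (WithLp.measurable_toLp 2 _)).comp (MeasurableEquiv.measurable _)).aemeasurable

/-- For a unit vector with first coordinate s, s/√(1 - s²) is the ratio of that coordinate to the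
length of the others; its derivative is the Jacobian of the slicing substitution. -/
theorem hasDerivAt_div_sqrt_one_sub_sq {s : ℝ} (hs : s ∈ Ioo (-1 : ℝ) 1) :
    HasDerivAt (fun s : ℝ => s / √(1 - s ^ 2)) ((1 - s ^ 2) ^ (-(3 / 2) : ℝ)) s := by
  have h0 : 0 < 1 - s ^ 2 := by nlinarith [hs.1, hs.2]
  have hw : 0 < √(1 - s ^ 2) := Real.sqrt_pos.2 h0
  have h1 : HasDerivAt (fun s : ℝ => 1 - s ^ 2) (-(2 * s)) s := by
    simpa using ((hasDerivAt_id s).pow 2).const_sub 1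
  have h2 := (hasDerivAt_id s).div (h1.sqrt h0.ne') hw.ne'
  have hr : (1 - s ^ 2) ^ (-(3 / 2) : ℝ) = (√(1 - s ^ 2) ^ 3)⁻¹ := by
    rw [Real.rpow_neg h0.le, Real.sqrt_eq_rpow, ← Real.rpow_natCast _ 3, ← Real.rpow_mul h0.le]
    norm_num
  have hsq : √(1 - s ^ 2) ^ 2 = 1 - s ^ 2 := Real.sq_sqrt h0.le
  refine h2.congr_deriv ?_
  rw [hr]
  set w := √(1 - s ^ 2)
  simp only [id]
  field_simp
  linarith

theorem image_div_sqrt_one_sub_sq {r : ℝ} (hr : 0 < r) :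
    (fun s : ℝ => r * (s / √(1 - s ^ 2))) '' Ioo (-1) 1 = univ := by
  refine eq_univ_of_forall fun a => ?_
  have hD : 0 < r ^ 2 + a ^ 2 := by positivity
  have hlt : |a| < √(r ^ 2 + a ^ 2) := Real.lt_sqrt_of_sq_lt (by rw [sq_abs]; nlinarith)
  have hD' := Real.sqrt_pos.2 hD
  have hsq := Real.sq_sqrt hD.le
  refine ⟨a / √(r ^ 2 + a ^ 2), abs_lt.1 ?_, ?_⟩
  · rwa [abs_div, abs_of_pos hD', div_lt_one hD']
  · have : 1 - (a / √(r ^ 2 + a ^ 2)) ^ 2 = (r / √(r ^ 2 + a ^ 2)) ^ 2 := by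
      rw [div_pow, div_pow, hsq]; field_simp; ring
    simp only [this]
    rw [Real.sqrt_sq (by positivity)]
    field_simp

theorem injOn_div_sqrt_one_sub_sq {r : ℝ} (hr : 0 < r) :
    InjOn (fun s : ℝ => r * (s / √(1 - s ^ 2))) (Ioo (-1) 1) := by
  have : StrictMonoOn (fun s : ℝ => s / √(1 - s ^ 2)) (Ioo (-1) 1) := by
    refine strictMonoOn_of_deriv_pos (convex_Ioo _ _)
      (fun s hs => (hasDerivAt_div_sqrt_one_sub_sq hs).continuousAt.continuousWithinAt) fun s hs => ?_
    rw [interior_Ioo] at hs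
    rw [(hasDerivAt_div_sqrt_one_sub_sq hs).deriv]
    exact Real.rpow_pos_of_pos (by nlinarith [hs.1, hs.2]) _
  intro a ha b hb hab
  exact this.injOn ha hb (mul_left_cancel₀ hr.ne' hab)

/-- The substitution a = r s/√(1 - s²): if the remaining coordinates have length r, then s is the
first coordinate of the normalized vector. -/
theorem lintegral_eq_lintegral_Ioo_slope {r : ℝ} (hr : 0 < r) (k : ℝ → ENNReal) :
    ∫⁻ a, k a = ∫⁻ s in Ioo (-1 : ℝ) 1,
      ENNReal.ofReal (r * (1 - s ^ 2) ^ (-(3 / 2) : ℝ)) * k (r * (s / √(1 - s ^ 2))) := by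
  rw [← setLIntegral_univ, ← image_div_sqrt_one_sub_sq hr,
    lintegral_image_eq_lintegral_abs_deriv_mul measurableSet_Ioo
      (fun s hs => ((hasDerivAt_div_sqrt_one_sub_sq hs).const_mul r).hasDerivWithinAt)
      (injOn_div_sqrt_one_sub_sq hr)]
  refine setLIntegral_congr_fun measurableSet_Ioo fun s hs => ?_
  have : 0 ≤ 1 - s ^ 2 := by nlinarith [hs.1, hs.2]
  rw [abs_of_nonneg (by positivity)]

/-- Slicing of the ball integral of a function of the direction by the first coordinate. -/
theorem lintegral_ball_normalize_slice (p : ℕ) {f : EuclideanSpace ℝ (Fin (p + 2)) → ENNReal}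
    (hf : Measurable f) :
    ∫⁻ x in Metric.ball (0 : EuclideanSpace ℝ (Fin (p + 2))) 1, f (‖x‖⁻¹ • x) =
      ENNReal.ofReal (1 / (p + 2)) * ∫⁻ s in Ioo (-1 : ℝ) 1,
        ENNReal.ofReal ((1 - s ^ 2) ^ ((p + 1 : ℝ) / 2 - 1)) *
          ∫⁻ ξ : Hypersphere p, f (euclideanCons s (√(1 - s ^ 2) • ξ))
            ∂(volume : Measure (EuclideanSpace ℝ (Fin (p + 1)))).toSphere := by
  set σ := (volume : Measure (EuclideanSpace ℝ (Fin (p + 1)))).toSphere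
  set H : EuclideanSpace ℝ (Fin (p + 2)) → ENNReal :=
    (Metric.ball 0 1).indicator fun x => f (‖x‖⁻¹ • x) with hH
  have hHm : Measurable H := Measurable.indicator (by fun_prop) measurableSet_ball
  have hHc := hHm.comp (measurable_euclideanCons (n := p + 1))
  set g : ℝ → Hypersphere p → ENNReal := fun s ξ => f (euclideanCons s (√(1 - s ^ 2) • ξ))
  have hg : Measurable fun z : ℝ × Hypersphere p => g z.1 z.2 := by
    refine hf.comp (measurable_euclideanCons.comp (f := fun z : ℝ × Hypersphere p =>
      (z.1, √(1 - z.1 ^ 2) • (z.2 : EuclideanSpace ℝ (Fin (p + 1)))))  ?_)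
    fun_prop
  -- In the variables (s, r, ξ) the point is r/√(1 - s²) times the unit vector (s, √(1 - s²) ξ). Its
  -- direction is free of r, and lying in the ball means r < √(1 - s²).
  have key : ∀ ξ : Hypersphere p, ∀ r ∈ Ioi (0 : ℝ),
      ENNReal.ofReal (r ^ p) * ∫⁻ a, H (euclideanCons a (r • (ξ : EuclideanSpace ℝ (Fin (p + 1))))) =
      ∫⁻ s in Ioo (-1 : ℝ) 1, ENNReal.ofReal ((1 - s ^ 2) ^ (-(3 / 2) : ℝ)) *
        ((Iio (√(1 - s ^ 2))).indicator (fun r => ENNReal.ofReal (r ^ (p + 1))) r * g s ξ) := by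
    intro ξ r hr
    have hr : 0 < r := hr
    rw [lintegral_eq_lintegral_Ioo_slope hr, ← lintegral_const_mul' _ _ ENNReal.ofReal_ne_top]
    refine setLIntegral_congr_fun measurableSet_Ioo fun s hs => ?_
    have h0 : 0 < 1 - s ^ 2 := by nlinarith [hs.1, hs.2]
    have hw : 0 < √(1 - s ^ 2) := Real.sqrt_pos.2 h0
    have hsq : √(1 - s ^ 2) ^ 2 = 1 - s ^ 2 := Real.sq_sqrt h0.le
    have hξ : ‖(ξ : EuclideanSpace ℝ (Fin (p + 1)))‖ = 1 := by simp
    have hx : euclideanCons (r * (s / √(1 - s ^ 2))) (r • (ξ : EuclideanSpace ℝ (Fin (p + 1)))) =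
        (r / √(1 - s ^ 2)) • euclideanCons s (√(1 - s ^ 2) • (ξ : EuclideanSpace ℝ (Fin (p + 1)))) := by
      rw [smul_euclideanCons, smul_smul]
      have : r / √(1 - s ^ 2) * √(1 - s ^ 2) = r := by field_simp
      rw [this, mul_div_assoc', div_mul_eq_mul_div]
    have hn1 : ‖euclideanCons s (√(1 - s ^ 2) • (ξ : EuclideanSpace ℝ (Fin (p + 1))))‖ = 1 := by
      rw [← sq_eq_sq₀ (norm_nonneg _) zero_le_one, norm_euclideanCons_sq, norm_smul, hξ, mul_one,
        Real.norm_of_nonneg hw.le, hsq]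
      ring
    have hn : ‖euclideanCons (r * (s / √(1 - s ^ 2))) (r • (ξ : EuclideanSpace ℝ (Fin (p + 1))))‖ =
        r / √(1 - s ^ 2) := by
      rw [hx, norm_smul, hn1, mul_one, Real.norm_of_nonneg (by positivity)]
    by_cases h1 : r < √(1 - s ^ 2)
    · rw [hH, indicator_of_mem (by rw [mem_ball_zero_iff, hn]; exact (div_lt_one hw).2 h1),
        indicator_of_mem (mem_Iio.2 h1), hn, hx, smul_smul, inv_mul_cancel₀ (by positivity), one_smul,
        ← mul_assoc, ← mul_assoc, ← ENNReal.ofReal_mul (by positivity),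
        ← ENNReal.ofReal_mul (by positivity)]
      congr 2
      ring
    · rw [hH, indicator_of_notMem (by rw [mem_ball_zero_iff, hn]; exact fun h => h1 ((div_lt_one hw).1 h)),
        indicator_of_notMem (by simpa using h1)]
      simp
  have hind : Measurable fun z : ℝ × ℝ =>
      (Iio (√(1 - z.1 ^ 2))).indicator (fun r => ENNReal.ofReal (r ^ (p + 1))) z.2 := by
    have : (fun z : ℝ × ℝ =>
        (Iio (√(1 - z.1 ^ 2))).indicator (fun r => ENNReal.ofReal (r ^ (p + 1))) z.2) =
        {z : ℝ × ℝ | z.2 < √(1 - z.1 ^ 2)}.indicator fun z => ENNReal.ofReal (z.2 ^ (p + 1)) := by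
      ext z; simp [indicator]
    rw [this]
    exact Measurable.indicator (by fun_prop) (measurableSet_lt (by fun_prop) (by fun_prop))
  have hrad : ∀ s ∈ Ioo (-1 : ℝ) 1, ∫⁻ r in Ioi (0 : ℝ),
      (Iio (√(1 - s ^ 2))).indicator (fun r => ENNReal.ofReal (r ^ (p + 1))) r =
        ENNReal.ofReal (√(1 - s ^ 2) ^ (p + 2) / (p + 2)) := by
    intro s hs
    rw [lintegral_indicator measurableSet_Iio, Measure.restrict_restrict measurableSet_Iio,
      Iio_inter_Ioi, lintegral_ofReal_pow_Ioo _ (Real.sqrt_nonneg _)]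
    congr 2
    push_cast; ring
  rw [← lintegral_indicator measurableSet_ball, ← hH, lintegral_euclideanCons hHm,
    lintegral_euclidean_polar p (Measurable.lintegral_prod_left (f := fun a (y : EuclideanSpace ℝ (Fin (p + 1))) =>
      H (euclideanCons a y)) hHc)]
  have hmeas3 : Measurable fun z : Hypersphere p × (ℝ × ℝ) =>
      ENNReal.ofReal ((1 - z.2.1 ^ 2) ^ (-(3 / 2) : ℝ)) *
        ((Iio (√(1 - z.2.1 ^ 2))).indicator (fun r => ENNReal.ofReal (r ^ (p + 1))) z.2.2 *
          g z.2.1 z.1) := by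
    refine Measurable.mul (by fun_prop) (Measurable.mul (hind.comp measurable_snd) ?_)
    exact hg.comp (f := fun z : Hypersphere p × (ℝ × ℝ) => (z.2.1, z.1)) (by fun_prop)
  calc _ = ∫⁻ ξ, (∫⁻ r in Ioi (0 : ℝ), ∫⁻ s in Ioo (-1 : ℝ) 1,
        ENNReal.ofReal ((1 - s ^ 2) ^ (-(3 / 2) : ℝ)) *
        ((Iio (√(1 - s ^ 2))).indicator (fun r => ENNReal.ofReal (r ^ (p + 1))) r * g s ξ)) ∂σ :=
      lintegral_congr fun ξ => setLIntegral_congr_fun measurableSet_Ioi (key ξ)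
    _ = ∫⁻ ξ, (∫⁻ s in Ioo (-1 : ℝ) 1, ∫⁻ r in Ioi (0 : ℝ),
        ENNReal.ofReal ((1 - s ^ 2) ^ (-(3 / 2) : ℝ)) *
        ((Iio (√(1 - s ^ 2))).indicator (fun r => ENNReal.ofReal (r ^ (p + 1))) r * g s ξ)) ∂σ := by
      refine lintegral_congr fun ξ => lintegral_lintegral_swap (Measurable.aemeasurable ?_)
      exact hmeas3.comp (f := fun z : ℝ × ℝ => (ξ, (z.2, z.1))) (by fun_prop)
    _ = ∫⁻ ξ, (∫⁻ s in Ioo (-1 : ℝ) 1,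
        ENNReal.ofReal (1 / (p + 2)) * (ENNReal.ofReal ((1 - s ^ 2) ^ ((p + 1 : ℝ) / 2 - 1)) * g s ξ)) ∂σ := by
      refine lintegral_congr fun ξ => setLIntegral_congr_fun measurableSet_Ioo fun s hs => ?_
      have h0 : 0 < 1 - s ^ 2 := by nlinarith [hs.1, hs.2]
      have hm1 : Measurable fun r => (Iio (√(1 - s ^ 2))).indicator
          (fun r => ENNReal.ofReal (r ^ (p + 1))) r :=
        Measurable.indicator (by fun_prop) measurableSet_Iio
      rw [lintegral_const_mul _ (hm1.mul_const _), lintegral_mul_const _ hm1, hrad s hs, ← mul_assoc,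
        ← mul_assoc, ← ENNReal.ofReal_mul (by positivity), ← ENNReal.ofReal_mul (by positivity)]
      congr 2
      -- The radial integral gives the exponent (p + 2)/2 and the Jacobian -3/2; their sum is (p +
      -- 1)/2 - 1.
      rw [Real.sqrt_eq_rpow, ← Real.rpow_natCast _ (p + 2), ← Real.rpow_mul h0.le, ← mul_div_assoc,
        ← Real.rpow_add h0, div_mul_eq_mul_div, one_mul]
      push_cast
      ring_nf
    _ = ∫⁻ s in Ioo (-1 : ℝ) 1, (∫⁻ ξ,
        ENNReal.ofReal (1 / (p + 2)) * (ENNReal.ofReal ((1 - s ^ 2) ^ ((p + 1 : ℝ) / 2 - 1)) * g s ξ) ∂σ) := by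
      refine lintegral_lintegral_swap (Measurable.aemeasurable ?_)
      refine Measurable.const_mul (Measurable.mul (by fun_prop) ?_) _
      exact hg.comp (f := fun z : Hypersphere p × ℝ => (z.2, z.1)) (by fun_prop)
    _ = _ := by
      rw [← lintegral_const_mul' _ _ ENNReal.ofReal_ne_top]
      refine setLIntegral_congr_fun measurableSet_Ioo fun s hs => ?_
      rw [lintegral_const_mul' _ _ ENNReal.ofReal_ne_top, lintegral_const_mul' _ _ ENNReal.ofReal_ne_top]

/-- The first coordinate `s` of a uniform point of `Ω_{p+1}` has density `projDensity (p + 1)`, and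
the normalized remaining coordinates are uniform on `Ω_p` given `s`. -/
theorem lintegral_uniformSphere_slice (p : ℕ) {f : EuclideanSpace ℝ (Fin (p + 2)) → ENNReal}
    (hf : Measurable f) :
    ∫⁻ ξ, f ξ ∂(uniformSphere (p + 1)) = ∫⁻ s in Ioo (-1 : ℝ) 1,
        ENNReal.ofReal (projDensity (p + 1) s) *
          ∫⁻ ξ, f (euclideanCons s (√(1 - s ^ 2) • ξ)) ∂(uniformSphere p) := by
  -- The normalizing constant of the density is the ratio of the areas of Ω_p and Ω_{p+1}.
  have hc : ENNReal.ofReal (ProbabilityTheory.beta (1 / 2) (((p + 1 : ℕ) : ℝ) / 2))⁻¹ =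
      ((volume : Measure (EuclideanSpace ℝ (Fin (p + 2)))).toSphere univ)⁻¹ *
      (volume : Measure (EuclideanSpace ℝ (Fin (p + 1)))).toSphere univ := by
    have hG1 := Real.Gamma_pos_of_pos (show (0 : ℝ) < ((p + 1 : ℝ)) / 2 by positivity)
    have hG2 := Real.Gamma_pos_of_pos (show (0 : ℝ) < ((p + 1 : ℝ) + 1) / 2 by positivity)
    rw [toSphere_univ_euclidean, toSphere_univ_euclidean,
      ← ENNReal.ofReal_inv_of_pos (by push_cast; positivity), ← ENNReal.ofReal_mul (by push_cast; positivity)]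
    congr 1
    rw [ProbabilityTheory.beta, Real.Gamma_one_half_eq]
    push_cast
    rw [show (1 / 2 + ((p : ℝ) + 1) / 2) = ((p : ℝ) + 1 + 1) / 2 by ring]
    field_simp
    ring
  rw [lintegral_uniformSphere (p + 1) hf, lintegral_ball_normalize_slice p hf, ← mul_assoc (ENNReal.ofReal _),
    ← ENNReal.ofReal_mul (by positivity)]
  have : ((p + 1 : ℕ) + 1 : ℝ) * (1 / (p + 2)) = 1 := by push_cast; field_simp; ring
  rw [this, ENNReal.ofReal_one, one_mul, ← lintegral_const_mul' _ _
    (ENNReal.inv_ne_top.2 (toSphere_univ_ne_zero _))]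
  refine setLIntegral_congr_fun measurableSet_Ioo fun s hs => ?_
  have hb := ProbabilityTheory.beta_pos (α := 1 / 2) (β := ((p + 1 : ℕ) : ℝ) / 2) (by norm_num) (by positivity)
  rw [projDensity, ENNReal.ofReal_mul (by positivity), hc, uniformSphere, lintegral_smul_measure,
    smul_eq_mul]
  -- Here b is the area of Ω_p, finite and nonzero; the factor b b⁻¹ is inserted to normalize the
  -- inner integral.
  have hx : ∀ a b c d : ENNReal, b * b⁻¹ = 1 → a * (c * d) = a * b * c * (b⁻¹ * d) := by
    intro a b c d h
    calc _ = a * (c * d) * (b * b⁻¹) := by rw [h, mul_one]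
      _ = _ := by ring
  push_cast
  exact hx _ _ _ _ (ENNReal.mul_inv_cancel (toSphere_univ_ne_zero _) (measure_ne_top _ _))

/-! ### Invariance under linear isometries. -/

/-- Lebesgue measure, the unit ball and the norm are all preserved by L, and the integral is a ball
integral of a function of the direction. -/
theorem lintegral_uniformSphere_isometry (q : ℕ)
    (L : EuclideanSpace ℝ (Fin (q + 1)) ≃ₗᵢ[ℝ] EuclideanSpace ℝ (Fin (q + 1)))
    {f : EuclideanSpace ℝ (Fin (q + 1)) → ENNReal} (hf : Measurable f) :
    ∫⁻ ξ, f (L ξ) ∂(uniformSphere q) = ∫⁻ ξ, f ξ ∂(uniformSphere q) := by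
  have hL : Measurable L := L.continuous.measurable
  have h := lintegral_uniformSphere q (hf.comp hL)
  simp only [Function.comp_apply] at h
  rw [lintegral_uniformSphere q hf, h]
  congr 2
  rw [← lintegral_indicator measurableSet_ball, ← lintegral_indicator measurableSet_ball,
    ← L.measurePreserving.lintegral_comp (f := (Metric.ball 0 1).indicator fun x => f (‖x‖⁻¹ • x))
      (Measurable.indicator (by fun_prop) measurableSet_ball)]
  refine lintegral_congr fun x => ?_
  simp [indicator]

theorem uniformSphere_apply_eq_lintegral (q : ℕ) {S : Set (EuclideanSpace ℝ (Fin (q + 1)))}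
    (hS : MeasurableSet S) :
    uniformSphere q {γ | (γ : EuclideanSpace ℝ (Fin (q + 1))) ∈ S} =
      ∫⁻ ξ, S.indicator 1 (ξ : EuclideanSpace ℝ (Fin (q + 1))) ∂(uniformSphere q) := by
  exact (lintegral_indicator_one (measurable_subtype_coe hS)).symm

theorem uniformSphere_isometry (q : ℕ)
    (L : EuclideanSpace ℝ (Fin (q + 1)) ≃ₗᵢ[ℝ] EuclideanSpace ℝ (Fin (q + 1)))
    {S : Set (EuclideanSpace ℝ (Fin (q + 1)))} (hS : MeasurableSet S) :
    uniformSphere q {γ | L (γ : EuclideanSpace ℝ (Fin (q + 1))) ∈ S} =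
      uniformSphere q {γ | (γ : EuclideanSpace ℝ (Fin (q + 1))) ∈ S} := by
  have hL : Measurable L := L.continuous.measurable
  rw [uniformSphere_apply_eq_lintegral q hS,
    ← lintegral_uniformSphere_isometry q L (measurable_one.indicator hS)]
  exact uniformSphere_apply_eq_lintegral q (hL hS)

/-- Two reflections suffice. The first sends u to u'. The second sends the image v₁ of v to v', and
it fixes u' because equality of the scalar products makes u' orthogonal to v₁ - v'. No independence
is needed: if a difference vanishes, that reflection is the identity. -/
theorem exists_linearIsometryEquiv_of_inner_eq {E : Type*} [NormedAddCommGroup E]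
    [InnerProductSpace ℝ E] {u v u' v' : E} (hu : ‖u‖ = ‖u'‖) (hv : ‖v‖ = ‖v'‖)
    (h : inner ℝ u v = inner ℝ u' v') : ∃ L : E ≃ₗᵢ[ℝ] E, L u = u' ∧ L v = v' := by
  set R₁ := Submodule.reflection (ℝ ∙ (u - u'))ᗮ
  have h1 : R₁ u = u' := Submodule.reflection_sub hu
  set v₁ := R₁ v
  set R₂ := Submodule.reflection (ℝ ∙ (v₁ - v'))ᗮ
  have h2 : R₂ v₁ = v' := Submodule.reflection_sub (by simpa [v₁] using hv)
  have h3 : R₂ u' = u' := by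
    rw [Submodule.reflection_eq_self_iff, Submodule.mem_orthogonal_singleton_iff_inner_left,
      inner_sub_right, ← h]
    conv_lhs => rw [← h1]
    rw [LinearIsometryEquiv.inner_map_map, sub_self]
  exact ⟨R₁.trans R₂, by simp [h1, h3], by simp [v₁, h2]⟩

theorem measurable_dotSphere {q : ℕ} (u : Hypersphere q) : Measurable fun γ => dotSphere γ u := by
  unfold dotSphere; fun_prop

/-- The joint law of two projections depends only on the scalar product of the two directions. -/
theorem uniformSphere_pair_eq {q : ℕ} {u v u' v' : Hypersphere q}
    (h : dotSphere u v = dotSphere u' v') {S : Set (ℝ × ℝ)} (hS : MeasurableSet S) :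
    uniformSphere q {γ | (dotSphere γ u, dotSphere γ v) ∈ S} =
      uniformSphere q {γ | (dotSphere γ u', dotSphere γ v') ∈ S} := by
  obtain ⟨L, hu, hv⟩ := exists_linearIsometryEquiv_of_inner_eq
    (show ‖(u : EuclideanSpace ℝ (Fin (q + 1)))‖ = ‖(u' : EuclideanSpace ℝ (Fin (q + 1)))‖ by simp)
    (show ‖(v : EuclideanSpace ℝ (Fin (q + 1)))‖ = ‖(v' : EuclideanSpace ℝ (Fin (q + 1)))‖ by simp) h
  have hm : Measurable fun x : EuclideanSpace ℝ (Fin (q + 1)) =>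
      ((inner ℝ x (u' : EuclideanSpace ℝ (Fin (q + 1))) : ℝ),
        (inner ℝ x (v' : EuclideanSpace ℝ (Fin (q + 1))) : ℝ)) := by fun_prop
  refine Eq.trans ?_ (uniformSphere_isometry q L (hm hS))
  congr 1
  ext γ
  simp only [dotSphere, mem_ofPred_eq, mem_preimage, ← hu, ← hv, LinearIsometryEquiv.inner_map_map]

theorem dotSphere_comm {q : ℕ} (u v : Hypersphere q) : dotSphere u v = dotSphere v u :=
  real_inner_comm _ _

theorem abs_dotSphere_le_one {q : ℕ} (u v : Hypersphere q) : |dotSphere u v| ≤ 1 := by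
  simpa [dotSphere] using abs_real_inner_le_norm (u : EuclideanSpace ℝ (Fin (q + 1)))
    (v : EuclideanSpace ℝ (Fin (q + 1)))

theorem dotSphere_arcPoint {q : ℕ} (hq : 1 ≤ q) (θ : ℝ) :
    dotSphere (arcPoint q 0) (arcPoint q θ) = Real.cos θ := by
  have hq0 : q ≠ 0 := by omega
  have h0 : Fin.last q ≠ 0 := fun e => hq0 (by simpa using congrArg Fin.val e)
  simp [dotSphere, arcPoint, hq0, inner_add_right, inner_smul_right, EuclideanSpace.inner_single_left,
    h0.symm]

theorem cos_angleSphere {q : ℕ} (u v : Hypersphere q) :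
    Real.cos (angleSphere u v) = dotSphere u v :=
  Real.cos_arccos (abs_le.1 (abs_dotSphere_le_one u v)).1 (abs_le.1 (abs_dotSphere_le_one u v)).2

theorem capOverlap_eq_capOverlapAngle {q : ℕ} (hq : 1 ≤ q) (u v : Hypersphere q) (x : ℝ) :
    capOverlap u v x = capOverlapAngle q (angleSphere u v) x := by
  have h : dotSphere u v = dotSphere (arcPoint q 0) (arcPoint q (angleSphere u v)) := by
    rw [dotSphere_arcPoint hq, cos_angleSphere]
  have := uniformSphere_pair_eq h (S := {z : ℝ × ℝ | z.1 ≤ x ∧ z.2 ≤ x})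
    ((measurableSet_le measurable_fst measurable_const).inter
      (measurableSet_le measurable_snd measurable_const))
  exact congrArg ENNReal.toReal this

/-! ### The law of one projection. -/

/-- The point `(a, b ξ)` of `Ω_{p+1}`, for `ξ` in `Ω_p` and `a² + b² = 1`. -/
def sphereCons {p : ℕ} (a b : ℝ) (h : a ^ 2 + b ^ 2 = 1) (ξ : Hypersphere p) : Hypersphere (p + 1) :=
  ⟨euclideanCons a (b • (ξ : EuclideanSpace ℝ (Fin (p + 1)))), by
    rw [mem_sphere_zero_iff_norm, ← sq_eq_sq₀ (norm_nonneg _) zero_le_one, norm_euclideanCons_sq,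
      norm_smul, mul_pow, Real.norm_eq_abs, sq_abs]
    simpa using h⟩

theorem inner_sphereCons {p : ℕ} (s r a b : ℝ) (h : a ^ 2 + b ^ 2 = 1) (ξ η : Hypersphere p) :
    inner ℝ (euclideanCons s (r • (ξ : EuclideanSpace ℝ (Fin (p + 1)))))
      (sphereCons a b h η : EuclideanSpace ℝ (Fin (p + 2))) = s * a + r * (b * dotSphere ξ η) := by
  simp only [sphereCons, inner_euclideanCons, inner_smul_left, inner_smul_right, dotSphere]
  simp only [conj_trivial]
  ring

instance (q : ℕ) : Nonempty (Hypersphere q) := ⟨⟨EuclideanSpace.single 0 1, by simp⟩⟩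

theorem measurable_projDensity (q : ℕ) : Measurable (projDensity q) := by
  unfold projDensity; fun_prop

/-- The law of a projection. -/
theorem lintegral_dotSphere {q : ℕ} (hq : 1 ≤ q) (u : Hypersphere q) {g : ℝ → ENNReal}
    (hg : Measurable g) :
    ∫⁻ γ, g (dotSphere γ u) ∂(uniformSphere q) =
      ∫⁻ s in Ioo (-1 : ℝ) 1, ENNReal.ofReal (projDensity q s) * g s := by
  obtain ⟨p, rfl⟩ := Nat.exists_eq_add_of_le' hq
  obtain ⟨ξ₀⟩ : Nonempty (Hypersphere p) := inferInstance
  set u' := sphereCons 1 0 (by norm_num) ξ₀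
  -- Only one direction has to be moved to the first axis, so the two-vector statement is used with
  -- equal vectors.
  obtain ⟨L, hu, -⟩ := exists_linearIsometryEquiv_of_inner_eq
    (show ‖(u : EuclideanSpace ℝ (Fin (p + 2)))‖ = ‖(u' : EuclideanSpace ℝ (Fin (p + 2)))‖ by simp)
    (show ‖(u : EuclideanSpace ℝ (Fin (p + 2)))‖ = ‖(u' : EuclideanSpace ℝ (Fin (p + 2)))‖ by simp)
    (by simp)
  have hm : Measurable fun x : EuclideanSpace ℝ (Fin (p + 2)) =>
      g (inner ℝ x (u' : EuclideanSpace ℝ (Fin (p + 2)))) := by fun_prop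
  have h1 := lintegral_uniformSphere_isometry (p + 1) L hm
  rw [lintegral_uniformSphere_slice p hm] at h1
  simp only [u', inner_sphereCons, mul_one, zero_mul, mul_zero, add_zero, lintegral_const, measure_univ] at h1
  rw [← h1]
  refine lintegral_congr fun γ => ?_
  rw [dotSphere, ← LinearIsometryEquiv.inner_map_map L, hu]

theorem projDensity_pos {q : ℕ} (hq : 1 ≤ q) {s : ℝ} (hs : s ∈ Ioo (-1 : ℝ) 1) :
    0 < projDensity q s := by
  have hb := ProbabilityTheory.beta_pos (α := 1 / 2) (β := (q : ℝ) / 2) (by norm_num)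
    (by have : (0 : ℝ) < q := by exact_mod_cast hq
        positivity)
  exact mul_pos (inv_pos.2 hb) (Real.rpow_pos_of_pos (by nlinarith [hs.1, hs.2]) _)

theorem projDensity_neg (q : ℕ) (s : ℝ) : projDensity q (-s) = projDensity q s := by
  simp [projDensity]

theorem integrableOn_projDensity {q : ℕ} (hq : 1 ≤ q) : IntegrableOn (projDensity q) (Ioo (-1) 1) := by
  obtain ⟨u⟩ : Nonempty (Hypersphere q) := inferInstance
  have h := lintegral_dotSphere hq u (g := 1) measurable_one
  simp only [Pi.one_apply, lintegral_const, measure_univ, mul_one] at h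
  refine ⟨(measurable_projDensity q).aestronglyMeasurable, ?_⟩
  rw [hasFiniteIntegral_iff_ofReal, ← h]
  · exact ENNReal.one_lt_top
  · exact (ae_restrict_mem measurableSet_Ioo).mono fun s hs => (projDensity_pos hq hs).le

theorem intervalIntegrable_projDensity {q : ℕ} (hq : 1 ≤ q) {a b : ℝ} (ha : a ∈ Icc (-1 : ℝ) 1)
    (hb : b ∈ Icc (-1 : ℝ) 1) : IntervalIntegrable (projDensity q) volume a b := by
  have : IntervalIntegrable (projDensity q) volume (-1) 1 := by
    rw [intervalIntegrable_iff_integrableOn_Ioo_of_le (by norm_num)]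
    exact integrableOn_projDensity hq
  exact this.mono_set (by rw [uIcc_of_le (by norm_num : (-1 : ℝ) ≤ 1)]; exact uIcc_subset_Icc ha hb)

theorem uniformSphere_real_dotSphere_le {q : ℕ} (hq : 1 ≤ q) (u : Hypersphere q) (x : ℝ) :
    (uniformSphere q).real {γ | dotSphere γ u ≤ x} = projCdf q x := by
  have h := lintegral_dotSphere hq u (g := (Iic x).indicator 1) (measurable_one.indicator measurableSet_Iic)
  have h1 : ∫⁻ γ, (Iic x).indicator 1 (dotSphere γ u) ∂(uniformSphere q) =
      uniformSphere q {γ | dotSphere γ u ≤ x} := 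
    lintegral_indicator_one (measurable_dotSphere u measurableSet_Iic)
  have h2 : ∀ s, ENNReal.ofReal (projDensity q s) * (Iic x).indicator 1 s =
      (Iic x).indicator (fun s => ENNReal.ofReal (projDensity q s)) s := by
    intro s; by_cases hs : s ≤ x <;> simp [indicator, hs]
  have h3 : Iic x ∩ Ioc (-1) 1 = Ioc (-1 : ℝ) (max (-1) (min x 1)) := by
    ext s; simp only [mem_inter_iff, mem_Iic, mem_Ioc, le_max_iff, le_min_iff]
    constructor
    · rintro ⟨h1, h2, h3⟩; exact ⟨h2, Or.inr ⟨h1, h3⟩⟩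
    · rintro ⟨h1, h2 | h2⟩
      · linarith
      · exact ⟨h2.1, h1, h2.2⟩
  have hc : max (-1) (min x 1) ∈ Icc (-1 : ℝ) 1 :=
    ⟨le_max_left _ _, max_le (by norm_num) (min_le_right _ _)⟩
  simp_rw [h1, h2] at h
  rw [lintegral_indicator measurableSet_Iic, Measure.restrict_restrict measurableSet_Iic,
    Measure.restrict_congr_set ((ae_eq_refl (Iic x)).inter Ioo_ae_eq_Ioc), h3] at h
  rw [Measure.real, h, projCdf, intervalIntegral.integral_of_le hc.1, integral_eq_lintegral_of_nonneg_ae]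
  -- Positivity of the density is known on the open interval only, while the range of integration
  -- may contain the endpoint 1.
  · have hmem : ∀ᵐ s : ℝ, s ≠ 1 := by simp [ae_iff]
    filter_upwards [ae_restrict_mem measurableSet_Ioc, ae_restrict_of_ae hmem] with s hs hs1
    exact (projDensity_pos hq ⟨hs.1, lt_of_le_of_ne (hs.2.trans hc.2) hs1⟩).le
  · exact (measurable_projDensity q).aestronglyMeasurable

/-- The law of a projection has a density. This is what allows strict and weak inequalities to be
exchanged under antipodes and reflections. -/
theorem uniformSphere_dotSphere_eq {q : ℕ} (hq : 1 ≤ q) (u : Hypersphere q) (x : ℝ) :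
    uniformSphere q {γ | dotSphere γ u = x} = 0 := by
  have h := lintegral_dotSphere hq u (g := ({x} : Set ℝ).indicator 1)
    (measurable_one.indicator (measurableSet_singleton x))
  have h1 : ∫⁻ γ, ({x} : Set ℝ).indicator 1 (dotSphere γ u) ∂(uniformSphere q) =
      uniformSphere q {γ | dotSphere γ u = x} := 
    lintegral_indicator_one (measurable_dotSphere u (measurableSet_singleton x))
  rw [← h1, h]
  refine (lintegral_eq_zero_iff (Measurable.mul (measurable_projDensity q).ennreal_ofReal
    (measurable_one.indicator (measurableSet_singleton x)))).2 ?_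
  have hmem : ∀ᵐ s : ℝ, s ≠ x := by simp [ae_iff]
  filter_upwards [ae_restrict_of_ae hmem] with s hs
  simp [hs]

/-! ### The distribution function F_q and its inverse. -/

theorem projCdf_of_mem (q : ℕ) {x : ℝ} (hx : x ∈ Icc (-1 : ℝ) 1) :
    projCdf q x = ∫ s in (-1)..x, projDensity q s := by
  rw [projCdf, min_eq_left hx.2, max_eq_right hx.1]

theorem projCdf_neg_one (q : ℕ) : projCdf q (-1) = 0 := by
  rw [projCdf_of_mem q (by norm_num), intervalIntegral.integral_same]

theorem projCdf_one {q : ℕ} (hq : 1 ≤ q) : projCdf q 1 = 1 := by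
  obtain ⟨u⟩ : Nonempty (Hypersphere q) := inferInstance
  rw [← uniformSphere_real_dotSphere_le hq u]
  have : {γ | dotSphere γ u ≤ 1} = univ :=
    eq_univ_of_forall fun γ => (abs_le.1 (abs_dotSphere_le_one γ u)).2
  rw [this, probReal_univ]

theorem projCdf_sub {q : ℕ} (hq : 1 ≤ q) {a b : ℝ} (ha : a ∈ Icc (-1 : ℝ) 1) (hb : b ∈ Icc (-1 : ℝ) 1) :
    projCdf q b - projCdf q a = ∫ s in a..b, projDensity q s := by
  rw [projCdf_of_mem q ha, projCdf_of_mem q hb, intervalIntegral.integral_interval_sub_left]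
  · exact intervalIntegrable_projDensity hq (by norm_num) hb
  · exact intervalIntegrable_projDensity hq (by norm_num) ha

theorem projCdf_neg {q : ℕ} (hq : 1 ≤ q) {x : ℝ} (hx : x ∈ Icc (-1 : ℝ) 1) :
    projCdf q (-x) = 1 - projCdf q x := by
  have h1 := projCdf_sub hq (a := x) (b := 1) hx (by norm_num)
  have h2 := intervalIntegral.integral_comp_neg (projDensity q) (a := x) (b := 1)
  simp_rw [projDensity_neg] at h2
  rw [projCdf_one hq] at h1
  rw [h1, h2, projCdf_of_mem q ⟨by linarith [hx.2], by linarith [hx.1]⟩]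

theorem projCdf_zero {q : ℕ} (hq : 1 ≤ q) : projCdf q 0 = 1 / 2 := by
  have := projCdf_neg hq (x := 0) (by norm_num)
  rw [neg_zero] at this
  linarith

theorem strictMonoOn_projCdf {q : ℕ} (hq : 1 ≤ q) : StrictMonoOn (projCdf q) (Icc (-1) 1) := by
  intro a ha b hb hab
  rw [← sub_pos, projCdf_sub hq ha hb]
  refine intervalIntegral.intervalIntegral_pos_of_pos_on (intervalIntegrable_projDensity hq ha hb)
    (fun s hs => projDensity_pos hq ⟨ha.1.trans_lt hs.1, hs.2.trans_le hb.2⟩) hab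

theorem continuousOn_projCdf {q : ℕ} (hq : 1 ≤ q) : ContinuousOn (projCdf q) (Icc (-1) 1) := by
  have h := intervalIntegral.continuousOn_primitive_interval (μ := volume) (f := projDensity q)
    (a := -1) (b := 1) (by
      rw [uIcc_of_le (by norm_num), integrableOn_Icc_iff_integrableOn_Ioo]
      exact integrableOn_projDensity hq)
  rw [uIcc_of_le (by norm_num)] at h
  exact h.congr fun x hx => projCdf_of_mem q hx

theorem measurable_projCdf {q : ℕ} (hq : 1 ≤ q) : Measurable (projCdf q) := by
  obtain ⟨u⟩ : Nonempty (Hypersphere q) := inferInstance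
  refine Monotone.measurable fun a b hab => ?_
  rw [← uniformSphere_real_dotSphere_le hq u, ← uniformSphere_real_dotSphere_le hq u]
  exact measureReal_mono fun γ (hγ : _ ≤ _) => hγ.trans hab

theorem exists_projCdf_eq {q : ℕ} (hq : 1 ≤ q) {p : ℝ} (hp : p ∈ Icc (0 : ℝ) 1) :
    ∃ x ∈ Icc (-1 : ℝ) 1, projCdf q x = p := by
  have := intermediate_value_Icc (by norm_num : (-1 : ℝ) ≤ 1) (continuousOn_projCdf hq)
  rw [projCdf_neg_one, projCdf_one hq] at this
  exact this hp

theorem projQuantile_mem {q : ℕ} (hq : 1 ≤ q) {p : ℝ} (hp : p ∈ Icc (0 : ℝ) 1) :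
    projQuantile q p ∈ Icc (-1 : ℝ) 1 :=
  Function.invFunOn_mem (exists_projCdf_eq hq hp)

theorem projCdf_projQuantile {q : ℕ} (hq : 1 ≤ q) {p : ℝ} (hp : p ∈ Icc (0 : ℝ) 1) :
    projCdf q (projQuantile q p) = p :=
  Function.invFunOn_eq (exists_projCdf_eq hq hp)

/-- The inverse is defined by choice, so its values are identified through injectivity of F_q on
[-1, 1]; the explicit quantiles for q = 1, 2 and the reflection rule rest on this. -/
theorem projQuantile_eq {q : ℕ} (hq : 1 ≤ q) {p x : ℝ} (hx : x ∈ Icc (-1 : ℝ) 1)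
    (h : projCdf q x = p) : projQuantile q p = x := by
  have hp : p ∈ Icc (0 : ℝ) 1 := by
    rw [← h, ← projCdf_one hq, ← projCdf_neg_one q]
    exact ⟨(strictMonoOn_projCdf hq).monotoneOn (by norm_num) hx hx.1,
      (strictMonoOn_projCdf hq).monotoneOn hx (by norm_num) hx.2⟩
  exact (strictMonoOn_projCdf hq).injOn (projQuantile_mem hq hp) hx
    ((projCdf_projQuantile hq hp).trans h.symm)

theorem projQuantile_one_sub {q : ℕ} (hq : 1 ≤ q) {p : ℝ} (hp : p ∈ Icc (0 : ℝ) 1) :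
    projQuantile q (1 - p) = -projQuantile q p := by
  have h := projQuantile_mem hq hp
  refine projQuantile_eq hq ⟨by linarith [h.2], by linarith [h.1]⟩ ?_
  rw [projCdf_neg hq h, projCdf_projQuantile hq hp]

theorem projQuantile_nonneg {q : ℕ} (hq : 1 ≤ q) {p : ℝ} (hp : p ∈ Icc (1 / 2 : ℝ) 1) :
    0 ≤ projQuantile q p := by
  have hp' : p ∈ Icc (0 : ℝ) 1 := ⟨by linarith [hp.1], hp.2⟩
  rw [← (strictMonoOn_projCdf hq).le_iff_le (by norm_num) (projQuantile_mem hq hp'),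
    projCdf_projQuantile hq hp', projCdf_zero hq]
  exact hp.1

/-! ### The circle in terms of the angle, and slicing of sets. -/

theorem lintegral_euclidean_fin_two {h : EuclideanSpace ℝ (Fin 2) → ENNReal} (hh : Measurable h) :
    ∫⁻ x, h x = ∫⁻ z : ℝ × ℝ, h !₂[z.1, z.2] := by
  have h1 := (PiLp.volume_preserving_toLp (Fin 2)).lintegral_comp hh
  have h2 := (volume_preserving_finTwoArrow ℝ).symm.lintegral_comp
    (hh.comp (WithLp.measurable_toLp 2 _))
  rw [← h1]
  simp only [Function.comp_apply] at h2
  rw [← h2]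
  rfl

theorem measurable_toLp_pair : Measurable fun z : ℝ × ℝ => (!₂[z.1, z.2] : EuclideanSpace ℝ (Fin 2)) := by
  refine (WithLp.measurable_toLp 2 _).comp (measurable_pi_lambda _ fun i => ?_)
  fin_cases i
  · exact measurable_fst
  · exact measurable_snd

/-- The uniform distribution on the circle is the image of the uniform distribution of the angle. -/
theorem lintegral_uniformSphere_one {f : EuclideanSpace ℝ (Fin 2) → ENNReal} (hf : Measurable f) :
    ∫⁻ ξ, f ξ ∂(uniformSphere 1) = ENNReal.ofReal (1 / (2 * Real.pi)) *
      ∫⁻ α in Ioo (-Real.pi) Real.pi, f !₂[Real.cos α, Real.sin α] := by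
  have hm : Measurable ((Metric.ball (0 : EuclideanSpace ℝ (Fin 2)) 1).indicator
      fun x => f (‖x‖⁻¹ • x)) := Measurable.indicator (by fun_prop) measurableSet_ball
  have hk : ∀ z ∈ polarCoord.target, ENNReal.ofReal z.1 *
      ((Metric.ball (0 : EuclideanSpace ℝ (Fin 2)) 1).indicator fun x => f (‖x‖⁻¹ • x))
        !₂[(polarCoord.symm z).1, (polarCoord.symm z).2] =
      (Iio 1).indicator (fun r => ENNReal.ofReal (r ^ 1)) z.1 * f !₂[Real.cos z.2, Real.sin z.2] := by
    rintro ⟨r, α⟩ ⟨hr : 0 < r, -⟩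
    have hx : (!₂[r * Real.cos α, r * Real.sin α] : EuclideanSpace ℝ (Fin 2)) =
        r • !₂[Real.cos α, Real.sin α] := by
      ext i; fin_cases i <;> simp
    have hn : ‖(!₂[r * Real.cos α, r * Real.sin α] : EuclideanSpace ℝ (Fin 2))‖ = r := by
      rw [EuclideanSpace.norm_eq, Fin.sum_univ_two]
      simp only [Matrix.cons_val_zero, Matrix.cons_val_one, Real.norm_eq_abs, sq_abs]
      rw [show (r * Real.cos α) ^ 2 + (r * Real.sin α) ^ 2 = r ^ 2 by
        nlinarith [Real.sin_sq_add_cos_sq α], Real.sqrt_sq hr.le]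
    simp only [polarCoord_symm_apply]
    by_cases h1 : r < 1
    · rw [indicator_of_mem (by rw [mem_ball_zero_iff, hn]; exact h1), indicator_of_mem (mem_Iio.2 h1),
        hn, hx, smul_smul, inv_mul_cancel₀ hr.ne', one_smul, pow_one]
    · rw [indicator_of_notMem (by rw [mem_ball_zero_iff, hn]; exact h1),
        indicator_of_notMem (by simpa using h1)]
      simp
  rw [lintegral_uniformSphere 1 hf, ← lintegral_indicator measurableSet_ball,
    lintegral_euclidean_fin_two hm, ← lintegral_comp_polarCoord_symm]
  simp only [smul_eq_mul]
  rw [setLIntegral_congr_fun polarCoord.open_target.measurableSet hk]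
  rw [show polarCoord.target = Ioi (0 : ℝ) ×ˢ Ioo (-Real.pi) Real.pi from rfl, Measure.volume_eq_prod,
    ← Measure.prod_restrict, lintegral_prod_mul (g := fun α => f !₂[Real.cos α, Real.sin α])
      (Measurable.aemeasurable (Measurable.indicator (by fun_prop) measurableSet_Iio))
      (Measurable.aemeasurable (hf.comp (measurable_toLp_pair.comp
        (Real.measurable_cos.prodMk Real.measurable_sin)))),
    lintegral_indicator measurableSet_Iio, Measure.restrict_restrict measurableSet_Iio,
    Iio_inter_Ioi, lintegral_ofReal_pow_Ioo _ zero_le_one, ← mul_assoc, ← mul_assoc, toSphere_univ_euclidean]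
  congr 1
  have hpi := Real.pi_pos
  have : 2 * √Real.pi ^ (1 + 1) / Real.Gamma ((((1 : ℕ) : ℝ) + 1) / 2) = 2 * Real.pi := by
    norm_num [Real.sq_sqrt hpi.le]
  rw [this, ← ENNReal.ofReal_inv_of_pos (by positivity), ← ENNReal.ofReal_mul (by positivity),
    ← ENNReal.ofReal_mul (by positivity)]
  congr 1
  push_cast
  field_simp

theorem uniformSphere_one_apply {S : Set (EuclideanSpace ℝ (Fin 2))} (hS : MeasurableSet S) :
    uniformSphere 1 {γ | (γ : EuclideanSpace ℝ (Fin 2)) ∈ S} = ENNReal.ofReal (1 / (2 * Real.pi)) *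
      volume ({α | !₂[Real.cos α, Real.sin α] ∈ S} ∩ Ioo (-Real.pi) Real.pi) := by
  have hm : Measurable fun α : ℝ => (!₂[Real.cos α, Real.sin α] : EuclideanSpace ℝ (Fin 2)) :=
    measurable_toLp_pair.comp (Real.measurable_cos.prodMk Real.measurable_sin)
  refine (uniformSphere_apply_eq_lintegral 1 hS).trans ?_
  rw [lintegral_uniformSphere_one (measurable_one.indicator hS)]
  congr 1
  exact (lintegral_indicator_one (hm hS)).trans (Measure.restrict_apply (hm hS))

theorem uniformSphere_slice (p : ℕ) {S : Set (EuclideanSpace ℝ (Fin (p + 2)))} (hS : MeasurableSet S) :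
    uniformSphere (p + 1) {γ | (γ : EuclideanSpace ℝ (Fin (p + 2))) ∈ S} = ∫⁻ s in Ioo (-1 : ℝ) 1,
      ENNReal.ofReal (projDensity (p + 1) s) *
        uniformSphere p {ξ | euclideanCons s (√(1 - s ^ 2) • (ξ : EuclideanSpace ℝ (Fin (p + 1)))) ∈ S} := by
  refine (uniformSphere_apply_eq_lintegral (p + 1) hS).trans ?_
  rw [lintegral_uniformSphere_slice p (measurable_one.indicator hS)]
  refine lintegral_congr fun s => ?_
  congr 1
  exact lintegral_indicator_one (((measurable_euclideanCons.comp (measurable_const.prodMk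
    (by fun_prop : Measurable fun ξ : Hypersphere p =>
      √(1 - s ^ 2) • (ξ : EuclideanSpace ℝ (Fin (p + 1))))))) hS)

/-! ### Intersections of two caps: the circle, and hemispheres. -/

/-- The probability that both projections on two directions at angle `θ` exceed `c`. -/
def capTail (q : ℕ) (θ c : ℝ) : ℝ :=
  (uniformSphere q).real {γ | c < dotSphere γ (arcPoint q 0) ∧ c < dotSphere γ (arcPoint q θ)}

theorem capTail_eq {q : ℕ} (hq : 1 ≤ q) {u v : Hypersphere q} {θ : ℝ} (h : dotSphere u v = Real.cos θ)
    (c : ℝ) : capTail q θ c = (uniformSphere q).real {γ | c < dotSphere γ u ∧ c < dotSphere γ v} :=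
  congrArg ENNReal.toReal (uniformSphere_pair_eq ((dotSphere_arcPoint hq θ).trans h.symm)
    (S := {z : ℝ × ℝ | c < z.1 ∧ c < z.2})
    ((measurableSet_lt measurable_const measurable_fst).inter
      (measurableSet_lt measurable_const measurable_snd)))

theorem arcPoint_one (θ : ℝ) : (arcPoint 1 θ : EuclideanSpace ℝ (Fin 2)) = !₂[Real.cos θ, Real.sin θ] := by
  ext i; fin_cases i <;> simp [arcPoint, Fin.last]

/-- The two conditions describe arcs of half-width β about 0 and θ. As β ≤ π/2, they cannot also
meet on the far side of the circle. -/
theorem cos_lt_cos_and_cos_lt_cos_sub_iff {β θ α : ℝ} (hβ : β ∈ Icc 0 (Real.pi / 2))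
    (hθ : θ ∈ Icc 0 Real.pi) (hα : α ∈ Ioo (-Real.pi) Real.pi) :
    (Real.cos β < Real.cos α ∧ Real.cos β < Real.cos (α - θ)) ↔ α ∈ Ioo (θ - β) β := by
  have hpi := Real.pi_pos
  have key : ∀ x, |x| ≤ Real.pi → (Real.cos β < Real.cos x ↔ |x| < β) := fun x hx => by
    rw [← Real.cos_abs x]
    exact Real.strictAntiOn_cos.lt_iff_gt ⟨hβ.1, by linarith [hβ.2]⟩ ⟨abs_nonneg _, hx⟩
  rw [key α (abs_le.2 ⟨hα.1.le, hα.2.le⟩)]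
  constructor
  · rintro ⟨h1, h2⟩
    rw [abs_lt] at h1
    rcases le_or_gt (-Real.pi) (α - θ) with h | h
    · rw [key _ (abs_le.2 ⟨h, by linarith [hθ.1, hα.2]⟩), abs_lt] at h2
      exact ⟨by linarith, h1.2⟩
    -- The wrap-around case: α - θ + 2π lies in [π/2, π], where the cosine is nonpositive, whereas
    -- cos β ≥ 0.
    · exfalso
      have h3 : Real.cos (α - θ) ≤ 0 := by
        rw [← Real.cos_add_two_pi]
        exact Real.cos_nonpos_of_pi_div_two_le_of_le (by linarith [h1.1, hβ.2, hθ.2]) (by linarith)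
      have h4 : 0 ≤ Real.cos β := Real.cos_nonneg_of_mem_Icc ⟨by linarith [hβ.1], hβ.2⟩
      linarith
  · rintro ⟨h1, h2⟩
    have h3 : |α - θ| < β := abs_lt.2 ⟨by linarith, by linarith [hθ.1]⟩
    exact ⟨abs_lt.2 ⟨by linarith [hθ.1], h2⟩, (key _ (by linarith [hβ.2])).2 h3⟩

/-- The intersection is the arc (θ - β, β), of length 2β - θ when this is positive and empty
otherwise. -/
theorem capTail_one {β θ : ℝ} (hβ : β ∈ Icc 0 (Real.pi / 2)) (hθ : θ ∈ Icc 0 Real.pi) :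
    capTail 1 θ (Real.cos β) = max (β / Real.pi - θ / (2 * Real.pi)) 0 := by
  have hpi := Real.pi_pos
  have hm : Measurable fun x : EuclideanSpace ℝ (Fin 2) =>
      ((inner ℝ x (arcPoint 1 0 : EuclideanSpace ℝ (Fin 2)) : ℝ),
        (inner ℝ x (arcPoint 1 θ : EuclideanSpace ℝ (Fin 2)) : ℝ)) := by fun_prop
  have hS : MeasurableSet {z : ℝ × ℝ | Real.cos β < z.1 ∧ Real.cos β < z.2} :=
    (measurableSet_lt measurable_const measurable_fst).inter
      (measurableSet_lt measurable_const measurable_snd)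
  have h := uniformSphere_one_apply (hm hS)
  have h2 : {α : ℝ | (!₂[Real.cos α, Real.sin α] : EuclideanSpace ℝ (Fin 2)) ∈
      (fun x : EuclideanSpace ℝ (Fin 2) =>
      ((inner ℝ x (arcPoint 1 0 : EuclideanSpace ℝ (Fin 2)) : ℝ),
        (inner ℝ x (arcPoint 1 θ : EuclideanSpace ℝ (Fin 2)) : ℝ))) ⁻¹'
        {z : ℝ × ℝ | Real.cos β < z.1 ∧ Real.cos β < z.2}} ∩ Ioo (-Real.pi) Real.pi = Ioo (θ - β) β := by
    ext α
    simp only [mem_inter_iff, mem_ofPred_eq, mem_preimage, arcPoint_one]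
    have e1 : inner ℝ (!₂[Real.cos α, Real.sin α] : EuclideanSpace ℝ (Fin 2))
        !₂[Real.cos 0, Real.sin 0] = Real.cos α := by
      simp [PiLp.inner_apply, Fin.sum_univ_two]
    have e2 : inner ℝ (!₂[Real.cos α, Real.sin α] : EuclideanSpace ℝ (Fin 2))
        !₂[Real.cos θ, Real.sin θ] = Real.cos (α - θ) := by
      simp [PiLp.inner_apply, Fin.sum_univ_two, Real.cos_sub]; ring
    rw [e1, e2]
    constructor
    · rintro ⟨h1, h2⟩
      exact (cos_lt_cos_and_cos_lt_cos_sub_iff hβ hθ h2).1 h1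
    · intro h1
      have h2 : α ∈ Ioo (-Real.pi) Real.pi := ⟨by linarith [h1.1, hθ.1, hβ.2], by linarith [h1.2, hβ.2]⟩
      exact ⟨(cos_lt_cos_and_cos_lt_cos_sub_iff hβ hθ h2).2 h1, h2⟩
  rw [h2, Real.volume_Ioo, ← ENNReal.ofReal_mul (by positivity)] at h
  refine (congrArg ENNReal.toReal h).trans ?_
  rw [ENNReal.toReal_ofReal', show 1 / (2 * Real.pi) * (β - (θ - β)) = β / Real.pi - θ / (2 * Real.pi) by
    field_simp; ring]

/-- The measure of the intersection of two hemispheres. -/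
theorem capTail_zero {q : ℕ} (hq : 1 ≤ q) {θ : ℝ} (hθ : θ ∈ Icc 0 Real.pi) :
    capTail q θ 0 = 1 / 2 - θ / (2 * Real.pi) := by
  have hpi := Real.pi_pos
  induction q, hq using Nat.le_induction with
  | base =>
    have h := capTail_one (β := Real.pi / 2) ⟨by positivity, le_rfl⟩ hθ
    rw [Real.cos_pi_div_two] at h
    rw [h, show Real.pi / 2 / Real.pi = 1 / 2 by field_simp, max_eq_left]
    rw [sub_nonneg, div_le_div_iff₀ (by positivity) (by norm_num)]
    linarith [hθ.2]
  | succ p hp ih =>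
    -- Both directions are placed orthogonal to the slicing coordinate. The factor √(1 - s²) does
    -- not affect signs, so every slice has the measure given by the induction hypothesis.
    set u := sphereCons 0 1 (by norm_num) (arcPoint p 0)
    set v := sphereCons 0 1 (by norm_num) (arcPoint p θ)
    have huv : dotSphere u v = Real.cos θ := by
      rw [← dotSphere_arcPoint hp]
      have := inner_sphereCons 0 1 0 1 (by norm_num) (arcPoint p 0) (arcPoint p θ)
      simpa [u, v, dotSphere, sphereCons] using this
    have hm : Measurable fun x : EuclideanSpace ℝ (Fin (p + 2)) =>
        ((inner ℝ x (u : EuclideanSpace ℝ (Fin (p + 2))) : ℝ),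
          (inner ℝ x (v : EuclideanSpace ℝ (Fin (p + 2))) : ℝ)) := by fun_prop
    have hS : MeasurableSet {z : ℝ × ℝ | 0 < z.1 ∧ 0 < z.2} :=
      (measurableSet_lt measurable_const measurable_fst).inter
        (measurableSet_lt measurable_const measurable_snd)
    have h := uniformSphere_slice p (hm hS)
    have hk : ∀ s ∈ Ioo (-1 : ℝ) 1, ENNReal.ofReal (projDensity (p + 1) s) *
        uniformSphere p {ξ | euclideanCons s (√(1 - s ^ 2) • (ξ : EuclideanSpace ℝ (Fin (p + 1)))) ∈
          (fun x : EuclideanSpace ℝ (Fin (p + 2)) =>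
        ((inner ℝ x (u : EuclideanSpace ℝ (Fin (p + 2))) : ℝ),
          (inner ℝ x (v : EuclideanSpace ℝ (Fin (p + 2))) : ℝ))) ⁻¹' {z : ℝ × ℝ | 0 < z.1 ∧ 0 < z.2}} =
        ENNReal.ofReal (projDensity (p + 1) s) * uniformSphere p
          {γ | 0 < dotSphere γ (arcPoint p 0) ∧ 0 < dotSphere γ (arcPoint p θ)} := by
      intro s hs
      have hw : 0 < √(1 - s ^ 2) := Real.sqrt_pos.2 (by nlinarith [hs.1, hs.2])
      congr 2
      ext ξ
      simp [u, v, inner_sphereCons, hw]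
    rw [setLIntegral_congr_fun measurableSet_Ioo hk, lintegral_mul_const _
      (measurable_projDensity _).ennreal_ofReal] at h
    have h1 := lintegral_dotSphere (q := p + 1) (by omega) u (g := 1) measurable_one
    simp only [Pi.one_apply, lintegral_const, measure_univ, mul_one] at h1
    rw [← h1, one_mul] at h
    rw [capTail_eq (by omega) huv, ← ih]
    exact congrArg ENNReal.toReal h

/-! ### The two-point weight and the reduction of the kernel to `capTail`. -/

theorem tMin_pos {t : ℝ} (ht : t ∈ Ioo (0 : ℝ) 1) : 0 < tMin t :=
  lt_min ht.1 (by linarith [ht.2])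

theorem tMin_le_half (t : ℝ) : tMin t ≤ 1 / 2 := by
  rcases le_total t (1 / 2) with h | h
  · exact (min_le_left _ _).trans h
  · exact (min_le_right _ _).trans (by linarith)

theorem tMin_mul_one_sub (t : ℝ) : tMin t * (1 - tMin t) = t * (1 - t) := by
  rcases min_choice t (1 - t) with h | h <;> rw [tMin, h]
  ring

theorem one_sub_tMin_mem {t : ℝ} (ht : t ∈ Ioo (0 : ℝ) 1) : 1 - tMin t ∈ Icc (1 / 2 : ℝ) 1 :=
  ⟨by linarith [tMin_le_half t], by linarith [tMin_pos ht]⟩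

theorem one_sub_tMin_mem_unit {t : ℝ} (ht : t ∈ Ioo (0 : ℝ) 1) : 1 - tMin t ∈ Icc (0 : ℝ) 1 :=
  ⟨by linarith [tMin_le_half t], by linarith [tMin_pos ht]⟩

/-- The map f need not be measurable: it agrees almost everywhere with a measurable function of two
values. It is applied to `projQuantile`, whose measurability is then never needed. -/
theorem map_dirac_add_dirac {α β : Type*} [MeasurableSpace α] [MeasurableSingletonClass α]
    [MeasurableSpace β] (f : α → β) (a b : α) :
    (Measure.dirac a + Measure.dirac b).map f = Measure.dirac (f a) + Measure.dirac (f b) := by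
  classical
  set g : α → β := fun x => if x = a then f a else f b with hg
  have hgm : Measurable g :=
    Measurable.ite (measurableSet_singleton a) measurable_const measurable_const
  have hga : g a = f a := if_pos rfl
  have hgb : g b = f b := by
    by_cases h : b = a
    · rw [h, hga]
    · exact if_neg h
  have h : f =ᵐ[Measure.dirac a + Measure.dirac b] g := by
    rw [Filter.EventuallyEq, ae_add_measure_iff, ae_dirac_eq, ae_dirac_eq]
    exact ⟨hga.symm, hgb.symm⟩
  rw [Measure.map_congr h, Measure.map_add _ _ hgm, Measure.map_dirac' hgm, Measure.map_dirac' hgm,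
    hga, hgb]

/-- By symmetry of F_q the quantile of order t_m is the negative of that of order 1 - t_m. For t =
1/2 both atoms sit at 0 and the formula persists. -/
theorem integral_projWeight_rothmanWeight {q : ℕ} (hq : 1 ≤ q) {t : ℝ} (ht : t ∈ Ioo (0 : ℝ) 1)
    (g : ℝ → ℝ) :
    ∫ x in Icc (-1 : ℝ) 1, g x ∂(projWeight q (rothmanWeight t)) =
      1 / 2 * (g (-projQuantile q (1 - tMin t)) + g (projQuantile q (1 - tMin t))) := by
  have hc := projQuantile_mem hq (one_sub_tMin_mem_unit ht)
  have hn : projQuantile q (tMin t) = -projQuantile q (1 - tMin t) := by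
    rw [← projQuantile_one_sub hq (one_sub_tMin_mem_unit ht), sub_sub_cancel]
  have hc' : -projQuantile q (1 - tMin t) ∈ Icc (-1 : ℝ) 1 := ⟨by linarith [hc.2], by linarith [hc.1]⟩
  classical
  rw [projWeight, rothmanWeight, Measure.map_smul, map_dirac_add_dirac, hn, Measure.restrict_smul,
    Measure.restrict_add, restrict_dirac, restrict_dirac, if_pos hc', if_pos hc,
    integral_smul_measure, integral_add_measure (integrable_dirac (by simp)) (integrable_dirac (by simp)),
    integral_dirac, integral_dirac]
  simp

theorem ae_dotSphere_ne {q : ℕ} (hq : 1 ≤ q) (u : Hypersphere q) (x : ℝ) :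
    ∀ᵐ γ ∂(uniformSphere q), dotSphere γ u ≠ x := by
  rw [ae_iff]
  simpa using uniformSphere_dotSphere_eq hq u x

theorem uniformSphere_real_lt_dotSphere {q : ℕ} (hq : 1 ≤ q) (u : Hypersphere q) (x : ℝ) :
    (uniformSphere q).real {γ | x < dotSphere γ u} = 1 - projCdf q x := by
  rw [← uniformSphere_real_dotSphere_le hq u,
    ← probReal_compl_eq_one_sub (s := {γ | dotSphere γ u ≤ x}) (measurable_dotSphere u measurableSet_Iic)]
  congr 1; ext γ; simp

/-- Inclusion-exclusion for the complements of the two caps. -/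
theorem capOverlapAngle_eq {q : ℕ} (hq : 1 ≤ q) (θ x : ℝ) :
    capOverlapAngle q θ x = 2 * projCdf q x - 1 + capTail q θ x := by
  have hm : ∀ u : Hypersphere q, MeasurableSet {γ | x < dotSphere γ u} := fun u =>
    measurable_dotSphere u measurableSet_Ioi
  have h := measureReal_union_add_inter (μ := uniformSphere q) (s := {γ | x < dotSphere γ (arcPoint q 0)})
    (hm (arcPoint q θ))
  rw [uniformSphere_real_lt_dotSphere hq, uniformSphere_real_lt_dotSphere hq] at h
  have h2 := probReal_compl_eq_one_sub (μ := uniformSphere q) ((hm (arcPoint q 0)).union (hm (arcPoint q θ)))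
  have h3 : ({γ | x < dotSphere γ (arcPoint q 0)} ∪ {γ | x < dotSphere γ (arcPoint q θ)})ᶜ =
      {γ | dotSphere γ (arcPoint q 0) ≤ x ∧ dotSphere γ (arcPoint q θ) ≤ x} := by
    ext γ; simp
  have h4 : capTail q θ x = (uniformSphere q).real ({γ | x < dotSphere γ (arcPoint q 0)} ∩
    {γ | x < dotSphere γ (arcPoint q θ)}) := rfl
  rw [h3] at h2
  rw [capOverlapAngle, capOverlap, h2, h4]
  linarith

/-- The antipodal map turns "both at most -x" into "both at least x"; the boundary is a null set. -/
theorem capOverlapAngle_neg {q : ℕ} (hq : 1 ≤ q) (θ x : ℝ) :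
    capOverlapAngle q θ (-x) = capTail q θ x := by
  have hm : Measurable fun y : EuclideanSpace ℝ (Fin (q + 1)) =>
      ((inner ℝ y (arcPoint q 0 : EuclideanSpace ℝ (Fin (q + 1))) : ℝ),
        (inner ℝ y (arcPoint q θ : EuclideanSpace ℝ (Fin (q + 1))) : ℝ)) := by fun_prop
  have hS : MeasurableSet {z : ℝ × ℝ | z.1 ≤ -x ∧ z.2 ≤ -x} :=
    (measurableSet_le measurable_fst measurable_const).inter
      (measurableSet_le measurable_snd measurable_const)
  have h := uniformSphere_isometry q (LinearIsometryEquiv.neg ℝ) (hm hS)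
  refine (congrArg ENNReal.toReal h.symm).trans (congrArg ENNReal.toReal (measure_congr ?_))
  filter_upwards [ae_dotSphere_ne hq (arcPoint q 0) x, ae_dotSphere_ne hq (arcPoint q θ) x] with γ h1 h2
  have e : ∀ u : Hypersphere q, x ≠ dotSphere γ u →
      (inner ℝ (-(γ : EuclideanSpace ℝ (Fin (q + 1)))) (u : EuclideanSpace ℝ (Fin (q + 1))) ≤ -x ↔
        x < dotSphere γ u) := fun u hu => by
    rw [inner_neg_left, neg_le_neg_iff, lt_iff_le_and_ne]
    exact (and_iff_left hu).symm
  exact propext (and_congr (e _ h1.symm) (e _ h2.symm))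

theorem projKernel_rothmanWeight {q : ℕ} (hq : 1 ≤ q) {t : ℝ} (ht : t ∈ Ioo (0 : ℝ) 1) (θ : ℝ) :
    projKernel q (rothmanWeight t) θ =
      1 / 2 - tMin t + capTail q θ (projQuantile q (1 - tMin t)) := by
  rw [projKernel, integral_projWeight_rothmanWeight hq ht, capOverlapAngle_neg hq,
    capOverlapAngle_eq hq, projCdf_projQuantile hq (one_sub_tMin_mem_unit ht)]
  ring

theorem cos_thresholdAngle_half {q : ℕ} (hq : 1 ≤ q) {t : ℝ} (ht : t ∈ Ioo (0 : ℝ) 1) :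
    Real.cos (thresholdAngle q t / 2) = projQuantile q (1 - tMin t) := by
  have hc := projQuantile_mem hq (one_sub_tMin_mem_unit ht)
  rw [thresholdAngle, mul_div_cancel_left₀ _ two_ne_zero, Real.cos_arccos hc.1 hc.2]

/-- For a unit vector γ the sum of the two projections is at most ‖u + v‖ = 2 cos(θ/2), so they
cannot both exceed c. -/
theorem capTail_eq_zero {q : ℕ} (hq : 1 ≤ q) {θ c : ℝ} (hθ : θ ∈ Icc 0 Real.pi)
    (h : Real.cos (θ / 2) ≤ c) : capTail q θ c = 0 := by
  have hempty : {γ : Hypersphere q | c < dotSphere γ (arcPoint q 0) ∧ c < dotSphere γ (arcPoint q θ)} = ∅ := by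
    refine eq_empty_of_forall_notMem fun γ ⟨h1, h2⟩ => ?_
    set u : EuclideanSpace ℝ (Fin (q + 1)) := (arcPoint q 0).1
    set v : EuclideanSpace ℝ (Fin (q + 1)) := (arcPoint q θ).1
    have huv : inner ℝ u v = Real.cos θ := dotSphere_arcPoint hq θ
    have h3 : inner ℝ (γ : EuclideanSpace ℝ (Fin (q + 1))) (u + v) ≤ ‖u + v‖ := by
      simpa using real_inner_le_norm (γ : EuclideanSpace ℝ (Fin (q + 1))) (u + v)
    have h0 : 0 ≤ Real.cos (θ / 2) :=
      Real.cos_nonneg_of_mem_Icc ⟨by linarith [hθ.1, Real.pi_pos], by linarith [hθ.2]⟩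
    have h4 : ‖u + v‖ = 2 * Real.cos (θ / 2) := by
      rw [← sq_eq_sq₀ (norm_nonneg _) (by positivity), norm_add_sq_real, huv]
      have hu : ‖u‖ = 1 := by simp [u]
      have hv : ‖v‖ = 1 := by simp [v]
      have h5 := Real.cos_two_mul (θ / 2)
      rw [mul_div_cancel₀ _ two_ne_zero] at h5
      rw [hu, hv, h5]; ring
    rw [inner_add_right, h4] at h3
    unfold dotSphere at h1 h2
    linarith
  rw [capTail, hempty, measureReal_empty]

theorem projKernel_of_threshold_le {q : ℕ} (hq : 1 ≤ q) {t : ℝ} (ht : t ∈ Ioo (0 : ℝ) 1) {θ : ℝ}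
    (hθ : θ ∈ Icc 0 Real.pi) (h : thresholdAngle q t ≤ θ) :
    projKernel q (rothmanWeight t) θ = 1 / 2 - tMin t := by
  rw [projKernel_rothmanWeight hq ht, capTail_eq_zero hq hθ, add_zero]
  rw [← cos_thresholdAngle_half hq ht]
  refine Real.cos_le_cos_of_nonneg_of_le_pi ?_ (by linarith [hθ.2, Real.pi_pos]) (by linarith)
  exact div_nonneg (mul_nonneg zero_le_two (Real.arccos_nonneg _)) zero_le_two

theorem thresholdAngle_le_pi {q : ℕ} (hq : 1 ≤ q) {t : ℝ} (ht : t ∈ Ioo (0 : ℝ) 1) :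
    thresholdAngle q t ≤ Real.pi := by
  have := Real.arccos_le_pi_div_two.2 (projQuantile_nonneg hq (one_sub_tMin_mem ht))
  unfold thresholdAngle
  linarith

/-! ### The kernel below the threshold angle, for q ≥ 2. -/

/-- The probability that the first of two projections lies in `(0, c]` and is the smaller one. -/
theorem uniformSphere_wedge {p : ℕ} (hp : 1 ≤ p) {θ c : ℝ} (hθ : θ ∈ Ico 0 Real.pi) (hc : c ∈ Ico (0 : ℝ) 1)
    {w u : Hypersphere (p + 1)} (η : Hypersphere p) (hu : u = sphereCons 1 0 (by norm_num) η)
    (hw : w = sphereCons (Real.sin (θ / 2)) (-Real.cos (θ / 2)) (by simp) η) :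
    (uniformSphere (p + 1)).real {γ | dotSphere γ w < 0 ∧ 0 < dotSphere γ u ∧ dotSphere γ u ≤ c} =
      ∫ s in (0 : ℝ)..c, (1 - projCdf p (s * Real.tan (θ / 2) / √(1 - s ^ 2))) * projDensity (p + 1) s := by
  have hcos : 0 < Real.cos (θ / 2) :=
    Real.cos_pos_of_mem_Ioo ⟨by linarith [hθ.1, Real.pi_pos], by linarith [hθ.2]⟩
  have hm : Measurable fun x : EuclideanSpace ℝ (Fin (p + 2)) =>
      ((inner ℝ x (w : EuclideanSpace ℝ (Fin (p + 2))) : ℝ),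
        (inner ℝ x (u : EuclideanSpace ℝ (Fin (p + 2))) : ℝ)) := by fun_prop
  have hS : MeasurableSet {z : ℝ × ℝ | z.1 < 0 ∧ 0 < z.2 ∧ z.2 ≤ c} :=
    (measurableSet_lt measurable_fst measurable_const).inter
      ((measurableSet_lt measurable_const measurable_snd).inter
        (measurableSet_le measurable_snd measurable_const))
  have h := uniformSphere_slice p (hm hS)
  set G : ℝ → ℝ := fun s =>
    (1 - projCdf p (s * Real.tan (θ / 2) / √(1 - s ^ 2))) * projDensity (p + 1) s with hG
  have hk : ∀ s ∈ Ioo (-1 : ℝ) 1, ENNReal.ofReal (projDensity (p + 1) s) *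
      uniformSphere p {ξ | euclideanCons s (√(1 - s ^ 2) • (ξ : EuclideanSpace ℝ (Fin (p + 1)))) ∈
        (fun x : EuclideanSpace ℝ (Fin (p + 2)) =>
      ((inner ℝ x (w : EuclideanSpace ℝ (Fin (p + 2))) : ℝ),
        (inner ℝ x (u : EuclideanSpace ℝ (Fin (p + 2))) : ℝ))) ⁻¹' {z : ℝ × ℝ | z.1 < 0 ∧ 0 < z.2 ∧ z.2 ≤ c}} =
      (Ioc 0 c).indicator (fun s => ENNReal.ofReal (G s)) s := by
    intro s hs
    have hr : 0 < √(1 - s ^ 2) := Real.sqrt_pos.2 (by nlinarith [hs.1, hs.2])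
    simp only [mem_preimage, mem_ofPred_eq, hu, hw, inner_sphereCons]
    by_cases h1 : s ∈ Ioc 0 c
    -- With first coordinate s fixed, the sign condition is linear in ξ'η. Dividing by √(1 - s²)
    -- cos(θ/2), positive because θ < π, leaves a lower bound on one projection in Ω_p.
    · have h2 : {ξ : Hypersphere p | s * Real.sin (θ / 2) + √(1 - s ^ 2) * (-Real.cos (θ / 2) * dotSphere ξ η) < 0 ∧
          0 < s * 1 + √(1 - s ^ 2) * (0 * dotSphere ξ η) ∧ s * 1 + √(1 - s ^ 2) * (0 * dotSphere ξ η) ≤ c} =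
          {ξ | s * Real.tan (θ / 2) / √(1 - s ^ 2) < dotSphere ξ η} := by
        ext ξ
        simp only [mem_ofPred_eq, mul_one, zero_mul, mul_zero, add_zero, h1.1, h1.2, and_true]
        rw [div_lt_iff₀ hr, Real.tan_eq_sin_div_cos, ← mul_div_assoc, div_lt_iff₀ hcos]
        constructor <;> intro h <;> nlinarith
      rw [h2, indicator_of_mem h1, ← ofReal_measureReal, uniformSphere_real_lt_dotSphere hp,
        ← ENNReal.ofReal_mul (projDensity_pos (by omega) hs).le, hG, mul_comm]
    · rw [indicator_of_notMem h1]
      have : {ξ : Hypersphere p | s * Real.sin (θ / 2) + √(1 - s ^ 2) * (-Real.cos (θ / 2) * dotSphere ξ η) < 0 ∧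
          0 < s * 1 + √(1 - s ^ 2) * (0 * dotSphere ξ η) ∧ s * 1 + √(1 - s ^ 2) * (0 * dotSphere ξ η) ≤ c} = ∅ := by
        refine eq_empty_of_forall_notMem fun ξ ⟨_, h3⟩ => h1 ?_
        simpa using h3
      rw [this, measure_empty, mul_zero]
  have hsub : Ioc 0 c ∩ Ioo (-1 : ℝ) 1 = Ioc 0 c :=
    inter_eq_left.2 fun s hs => ⟨by linarith [hs.1], hs.2.trans_lt hc.2⟩
  rw [setLIntegral_congr_fun measurableSet_Ioo hk, lintegral_indicator measurableSet_Ioc,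
    Measure.restrict_restrict measurableSet_Ioc, hsub] at h
  refine (congrArg ENNReal.toReal h).trans ?_
  rw [intervalIntegral.integral_of_le hc.1, integral_eq_lintegral_of_nonneg_ae]
  · filter_upwards [ae_restrict_mem measurableSet_Ioc] with s hs
    refine mul_nonneg ?_ (projDensity_pos (by omega) ⟨by linarith [hs.1], hs.2.trans_lt hc.2⟩).le
    rw [← uniformSphere_real_lt_dotSphere hp η]
    exact measureReal_nonneg
  · refine Measurable.aestronglyMeasurable (Measurable.mul ?_ (measurable_projDensity _))
    exact measurable_const.sub ((measurable_projCdf hp).comp (by fun_prop))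

theorem intervalIntegrable_projCdf_mul_projDensity {p : ℕ} (hp : 1 ≤ p) (τ : ℝ) {c : ℝ}
    (hc : c ∈ Icc (0 : ℝ) 1) :
    IntervalIntegrable (fun s => projCdf p (s * τ / √(1 - s ^ 2)) * projDensity (p + 1) s) volume 0 c := by
  obtain ⟨η⟩ : Nonempty (Hypersphere p) := inferInstance
  have h := intervalIntegrable_projDensity (q := p + 1) (by omega) (a := 0) (b := c) (by norm_num)
    ⟨by linarith [hc.1], hc.2⟩
  rw [intervalIntegrable_iff] at h ⊢
  refine Integrable.bdd_mul (c := 1) h ?_ (Filter.Eventually.of_forall fun s => ?_)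
  · exact ((measurable_projCdf hp).comp (by fun_prop)).aestronglyMeasurable
  · rw [← uniformSphere_real_dotSphere_le hp η, Real.norm_of_nonneg measureReal_nonneg]
    exact measureReal_le_one

/-- The difference is the measure of the set where the smaller projection lies in (0, c]. Up to a
null set it splits into B (γ'u smaller) and C (γ'v smaller), and the reflection exchanging u and v
carries one to the other. -/
theorem capTail_sub {p : ℕ} (hp : 1 ≤ p) {θ c : ℝ} (hθ : θ ∈ Ico 0 Real.pi) (hc : c ∈ Ico (0 : ℝ) 1) :
    capTail (p + 1) θ 0 - capTail (p + 1) θ c =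
      2 * ∫ s in (0 : ℝ)..c, (1 - projCdf p (s * Real.tan (θ / 2) / √(1 - s ^ 2))) * projDensity (p + 1) s := by
  obtain ⟨η⟩ : Nonempty (Hypersphere p) := inferInstance
  set u : Hypersphere (p + 1) := sphereCons 1 0 (by norm_num) η with hu
  set v : Hypersphere (p + 1) := sphereCons (Real.cos θ) (Real.sin θ) (by simp) η with hv
  -- The unit normal of the hyperplane bisecting u and v, with u - v = 2 sin(θ/2) w. Written in half
  -- angles it still makes sense at θ = 0, where u = v and the splitting remains valid.
  set w : Hypersphere (p + 1) := sphereCons (Real.sin (θ / 2)) (-Real.cos (θ / 2)) (by simp) η with hw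
  set ν := uniformSphere (p + 1)
  have hθ2 : θ = 2 * (θ / 2) := by ring
  have hsin : Real.sin θ = 2 * Real.sin (θ / 2) * Real.cos (θ / 2) := by
    conv_lhs => rw [hθ2, Real.sin_two_mul]
  have hcos : Real.cos θ = 1 - 2 * Real.sin (θ / 2) ^ 2 := by
    conv_lhs => rw [hθ2, Real.cos_two_mul, Real.cos_sq']
    ring
  have hs0 : 0 ≤ Real.sin (θ / 2) :=
    Real.sin_nonneg_of_nonneg_of_le_pi (by linarith [hθ.1]) (by linarith [hθ.2, Real.pi_pos])
  have hvw : (v : EuclideanSpace ℝ (Fin (p + 2))) = (u : EuclideanSpace ℝ (Fin (p + 2))) -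
      (2 * Real.sin (θ / 2)) • (w : EuclideanSpace ℝ (Fin (p + 2))) := by
    ext i
    refine Fin.cases ?_ (fun i => ?_) i
    · simp [u, v, w, sphereCons, euclideanCons, hcos]; ring
    · simp [u, v, w, sphereCons, euclideanCons, hsin]; ring
  have huv : dotSphere u v = Real.cos θ := by
    have := inner_sphereCons 1 0 (Real.cos θ) (Real.sin θ) (by simp) η η
    simpa [u, v, dotSphere, sphereCons] using this
  have huw : inner ℝ (u : EuclideanSpace ℝ (Fin (p + 2))) (w : EuclideanSpace ℝ (Fin (p + 2))) =
      Real.sin (θ / 2) := by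
    have := inner_sphereCons 1 0 (Real.sin (θ / 2)) (-Real.cos (θ / 2)) (by simp) η η
    simpa [u, w, sphereCons] using this
  have hdot : ∀ γ : Hypersphere (p + 1),
      dotSphere γ v = dotSphere γ u - 2 * Real.sin (θ / 2) * dotSphere γ w := fun γ => by
    simp only [dotSphere, hvw, inner_sub_right, inner_smul_right]
  have hww : ‖(w : EuclideanSpace ℝ (Fin (p + 2)))‖ = 1 := by simp
  set R := Submodule.reflection (ℝ ∙ (w : EuclideanSpace ℝ (Fin (p + 2))))ᗮ
  have hRw : R w = -w := Submodule.reflection_orthogonalComplement_singleton_eq_neg _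
  have hRu : R u = v := by
    rw [Submodule.reflection_orthogonal_apply, Submodule.reflection_singleton_apply,
      real_inner_comm, huw, hww, hvw]
    module
  have hmB : MeasurableSet {z : ℝ × ℝ | z.1 < 0 ∧ 0 < z.2 ∧ z.2 ≤ c} :=
    (measurableSet_lt measurable_fst measurable_const).inter
      ((measurableSet_lt measurable_const measurable_snd).inter
        (measurableSet_le measurable_snd measurable_const))
  set B : Set (Hypersphere (p + 1)) := {γ | dotSphere γ w < 0 ∧ 0 < dotSphere γ u ∧ dotSphere γ u ≤ c} with hB
  set C : Set (Hypersphere (p + 1)) := {γ | 0 < dotSphere γ w ∧ 0 < dotSphere γ v ∧ dotSphere γ v ≤ c} with hC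
  have hBC : ν.real C = ν.real B := by
    have hm : Measurable fun x : EuclideanSpace ℝ (Fin (p + 2)) =>
      ((inner ℝ x (w : EuclideanSpace ℝ (Fin (p + 2))) : ℝ),
        (inner ℝ x (u : EuclideanSpace ℝ (Fin (p + 2))) : ℝ)) := by fun_prop
    refine Eq.trans ?_ (congrArg ENNReal.toReal (uniformSphere_isometry (p + 1) R (hm hmB)))
    refine congrArg ν.real ?_
    ext γ
    have e1 : inner ℝ (R γ) (w : EuclideanSpace ℝ (Fin (p + 2))) = -dotSphere γ w := by
      rw [← neg_neg (w : EuclideanSpace ℝ (Fin (p + 2))), ← hRw, inner_neg_right,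
        LinearIsometryEquiv.inner_map_map]
      rfl
    have e2 : inner ℝ (R γ) (u : EuclideanSpace ℝ (Fin (p + 2))) = dotSphere γ v := by
      rw [dotSphere, ← LinearIsometryEquiv.inner_map_map R, ← hRu, Submodule.reflection_reflection]
    simp only [hC, mem_ofPred_eq, mem_preimage, e1, e2, neg_neg_iff_pos]
  have hmeas : ∀ u : Hypersphere (p + 1), Measurable fun γ => dotSphere γ u := measurable_dotSphere
  have hCm : MeasurableSet C := (measurableSet_lt measurable_const (hmeas w)).inter
      ((measurableSet_lt measurable_const (hmeas v)).inter (measurableSet_le (hmeas v) measurable_const))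
  have hd : Disjoint B C := by
    rw [Set.disjoint_left]
    rintro γ ⟨h1, -⟩ ⟨h2, -⟩
    exact lt_asymm h1 h2
  have hEm : MeasurableSet {γ : Hypersphere (p + 1) | c < dotSphere γ u ∧ c < dotSphere γ v} :=
    (measurableSet_lt measurable_const (hmeas u)).inter (measurableSet_lt measurable_const (hmeas v))
  have hae : ({γ | 0 < dotSphere γ u ∧ 0 < dotSphere γ v} \ {γ | c < dotSphere γ u ∧ c < dotSphere γ v} :
      Set (Hypersphere (p + 1))) =ᵐ[ν] (B ∪ C : Set (Hypersphere (p + 1))) := by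
    -- Off the null set γ'w = 0, the sign of γ'w decides which projection is the smaller.
    filter_upwards [ae_dotSphere_ne (by omega) w 0] with γ hγ
    refine propext ?_
    change (γ ∈ ({γ | 0 < dotSphere γ u ∧ 0 < dotSphere γ v} \
      {γ | c < dotSphere γ u ∧ c < dotSphere γ v} : Set (Hypersphere (p + 1)))) ↔ γ ∈ B ∪ C
    simp only [mem_sdiff, mem_union, mem_ofPred_eq, hB, hC]
    have hv' := hdot γ
    rcases lt_or_gt_of_ne hγ with h | h
    · have : dotSphere γ u ≤ dotSphere γ v := by nlinarith
      constructor
      · rintro ⟨⟨h1, h2⟩, h3⟩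
        exact Or.inl ⟨h, h1, le_of_not_gt fun h4 => h3 ⟨h4, h4.trans_le this⟩⟩
      · rintro (⟨-, h1, h2⟩ | ⟨h1, -⟩)
        · exact ⟨⟨h1, h1.trans_le this⟩, fun h3 => absurd h3.1 (not_lt.2 h2)⟩
        · exact absurd h1 (lt_asymm h)
    · have : dotSphere γ v ≤ dotSphere γ u := by nlinarith
      constructor
      · rintro ⟨⟨h1, h2⟩, h3⟩
        exact Or.inr ⟨h, h2, le_of_not_gt fun h4 => h3 ⟨h4.trans_le this, h4⟩⟩
      · rintro (⟨h1, -⟩ | ⟨-, h1, h2⟩)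
        · exact absurd h1 (lt_asymm h)
        · exact ⟨⟨h1.trans_le this, h1⟩, fun h3 => absurd h3.2 (not_lt.2 h2)⟩
  rw [capTail_eq (by omega) huv, capTail_eq (by omega) huv, ← measureReal_sdiff _ hEm,
    measureReal_congr hae, measureReal_union hd hCm, hBC, hB, uniformSphere_wedge hp hθ hc η hu hw]
  · ring
  · exact fun γ hγ => ⟨hc.1.trans_lt hγ.1, hc.1.trans_lt hγ.2⟩

theorem projQuantile_one_sub_tMin_mem {q : ℕ} (hq : 1 ≤ q) {t : ℝ} (ht : t ∈ Ioo (0 : ℝ) 1) :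
    projQuantile q (1 - tMin t) ∈ Ico (0 : ℝ) 1 := by
  refine ⟨projQuantile_nonneg hq (one_sub_tMin_mem ht), ?_⟩
  have hm := projQuantile_mem hq (one_sub_tMin_mem_unit ht)
  rw [← (strictMonoOn_projCdf hq).lt_iff_lt hm (by norm_num),
    projCdf_projQuantile hq (one_sub_tMin_mem_unit ht), projCdf_one hq]
  linarith [tMin_pos ht]

/-- T(θ, c) is T(θ, 0) minus the two wedges. The part of the wedge integral without F_{q-1} is
F_q(c) - F_q(0) = 1/2 - t_m. -/
theorem projKernel_of_lt_threshold {q : ℕ} (hq : 2 ≤ q) {t : ℝ} (ht : t ∈ Ioo (0 : ℝ) 1) {θ : ℝ}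
    (hθ : θ ∈ Icc 0 Real.pi) (h : θ < thresholdAngle q t) :
    projKernel q (rothmanWeight t) θ = tMin t - θ / (2 * Real.pi)
      + 2 * ∫ s in (0 : ℝ)..(Real.cos (thresholdAngle q t / 2)),
          projCdf (q - 1) (s * Real.tan (θ / 2) / √(1 - s ^ 2)) * projDensity q s := by
  obtain ⟨p, rfl⟩ := Nat.exists_eq_add_of_le' (show 1 ≤ q by omega)
  have hp : 1 ≤ p := by omega
  have hq1 : 1 ≤ p + 1 := by omega
  have hc := projQuantile_one_sub_tMin_mem hq1 ht
  have hsub := capTail_sub hp ⟨hθ.1, h.trans_le (thresholdAngle_le_pi hq1 ht)⟩ hc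
  have hF := projCdf_sub hq1 (a := 0) (by norm_num) (projQuantile_mem hq1 (one_sub_tMin_mem_unit ht))
  rw [projCdf_projQuantile hq1 (one_sub_tMin_mem_unit ht), projCdf_zero hq1] at hF
  simp_rw [sub_mul, one_mul] at hsub
  rw [intervalIntegral.integral_sub (intervalIntegrable_projDensity hq1 (by norm_num)
    ⟨by linarith [hc.1], hc.2.le⟩) (intervalIntegrable_projCdf_mul_projDensity hp _ ⟨hc.1, hc.2.le⟩),
    ← hF, capTail_zero hq1 hθ] at hsub
  rw [projKernel_rothmanWeight hq1 ht, cos_thresholdAngle_half hq1 ht, Nat.add_sub_cancel]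
  linarith

/-! ### Closed forms for q = 1, 2, 3. -/

theorem Real.Gamma_three_halves : Real.Gamma (3 / 2) = √Real.pi / 2 := by
  rw [show (3 / 2 : ℝ) = 1 / 2 + 1 by norm_num, Real.Gamma_add_one (by norm_num), Real.Gamma_one_half_eq]
  ring

theorem projDensity_one (s : ℝ) : projDensity 1 s = Real.pi⁻¹ * (1 - s ^ 2) ^ (-(1 / 2) : ℝ) := by
  rw [projDensity, ProbabilityTheory.beta, Nat.cast_one, Real.Gamma_one_half_eq, Real.mul_self_sqrt Real.pi_pos.le]
  norm_num

theorem projDensity_two (s : ℝ) : projDensity 2 s = 1 / 2 := by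
  have hpi : √Real.pi ≠ 0 := (Real.sqrt_pos.2 Real.pi_pos).ne'
  rw [projDensity, ProbabilityTheory.beta]
  norm_num [Real.Gamma_one_half_eq, Real.Gamma_three_halves]
  field_simp

theorem projDensity_three (s : ℝ) : projDensity 3 s = 2 / Real.pi * √(1 - s ^ 2) := by
  have hpi : 0 < √Real.pi := Real.sqrt_pos.2 Real.pi_pos
  rw [projDensity, ProbabilityTheory.beta, Real.sqrt_eq_rpow]
  norm_num [Real.Gamma_one_half_eq, Real.Gamma_three_halves]
  left
  rw [← div_eq_mul_inv, div_div, Real.mul_self_sqrt Real.pi_pos.le]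

theorem projCdf_one_eq {x : ℝ} (hx : x ∈ Icc (-1 : ℝ) 1) :
    projCdf 1 x = 1 - Real.arccos x / Real.pi := by
  have hpi := Real.pi_pos
  rw [projCdf_of_mem 1 hx, intervalIntegral.integral_eq_sub_of_hasDerivAt_of_le hx.1
    (f := fun s => Real.arcsin s / Real.pi)]
  · rw [Real.arcsin_neg_one, Real.arccos]
    field_simp
    ring
  · exact (Real.continuous_arcsin.div_const _).continuousOn
  · intro s hs
    have hs2 : s < 1 := hs.2.trans_le hx.2
    have h0 : 0 ≤ 1 - s ^ 2 := by nlinarith [hs.1]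
    refine ((Real.hasDerivAt_arcsin hs.1.ne' hs2.ne).div_const _).congr_deriv ?_
    rw [projDensity_one, Real.rpow_neg h0, Real.sqrt_eq_rpow]
    field_simp
  · exact intervalIntegrable_projDensity le_rfl (by norm_num) hx

theorem projCdf_two_eq {x : ℝ} (hx : x ∈ Icc (-1 : ℝ) 1) : projCdf 2 x = (1 + x) / 2 := by
  rw [projCdf_of_mem 2 hx]
  simp only [projDensity_two, intervalIntegral.integral_const, smul_eq_mul]
  ring

theorem projQuantile_one_eq {t : ℝ} (ht : t ∈ Icc (0 : ℝ) 1) :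
    projQuantile 1 (1 - t) = Real.cos (Real.pi * t) := by
  have hpi := Real.pi_pos
  refine projQuantile_eq le_rfl ⟨Real.neg_one_le_cos _, Real.cos_le_one _⟩ ?_
  rw [projCdf_one_eq ⟨Real.neg_one_le_cos _, Real.cos_le_one _⟩,
    Real.arccos_cos (mul_nonneg hpi.le ht.1) (by nlinarith [ht.2])]
  field_simp

theorem projQuantile_two_eq {p : ℝ} (hp : p ∈ Icc (0 : ℝ) 1) : projQuantile 2 (1 - p) = 1 - 2 * p := by
  have hm : 1 - 2 * p ∈ Icc (-1 : ℝ) 1 := ⟨by linarith [hp.2], by linarith [hp.1]⟩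
  refine projQuantile_eq one_le_two hm ?_
  rw [projCdf_two_eq hm]
  ring

theorem projKernel_one {t : ℝ} (ht : t ∈ Ioo (0 : ℝ) 1) {θ : ℝ} (hθ : θ ∈ Icc 0 Real.pi) :
    projKernel 1 (rothmanWeight t) θ = rothmanH t θ + 1 / 2 - t * (1 - t) := by
  have hpi := Real.pi_pos
  have h0 := tMin_pos ht
  have h1 := tMin_le_half t
  rw [projKernel_rothmanWeight le_rfl ht, projQuantile_one_eq ⟨h0.le, by linarith⟩,
    capTail_one ⟨by positivity, by nlinarith⟩ hθ, rothmanH, ← tMin_mul_one_sub t,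
    mul_div_cancel_left₀ _ hpi.ne']
  ring

/-- From s ≤ cos(θ/2) one gets s²(1 + tan²(θ/2)) ≤ 1. Below the threshold the argument of F_{q-1}
therefore stays in [0, 1], where the explicit formulas for F_1 and F_2 hold. -/
theorem slope_mem {θ s : ℝ} (hθ : θ ∈ Ico 0 Real.pi) (hs : s ∈ Icc 0 (Real.cos (θ / 2))) (hs1 : s < 1) :
    s * Real.tan (θ / 2) / √(1 - s ^ 2) ∈ Icc (0 : ℝ) 1 := by
  have hcos : 0 < Real.cos (θ / 2) :=
    Real.cos_pos_of_mem_Ioo ⟨by linarith [hθ.1, Real.pi_pos], by linarith [hθ.2]⟩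
  have htan : 0 ≤ Real.tan (θ / 2) := Real.tan_nonneg_of_nonneg_of_le_pi_div_two
    (by linarith [hθ.1]) (by linarith [hθ.2])
  have hr : 0 < 1 - s ^ 2 := by nlinarith [hs.1]
  refine ⟨div_nonneg (mul_nonneg hs.1 htan) (Real.sqrt_nonneg _), ?_⟩
  rw [div_le_one (Real.sqrt_pos.2 hr)]
  refine Real.le_sqrt_of_sq_le ?_
  have h1 := Real.tan_sq_div_one_add_tan_sq hcos.ne'
  have h2 := Real.inv_one_add_tan_sq hcos.ne'
  have h3 : s ^ 2 * (1 + Real.tan (θ / 2) ^ 2) ≤ 1 := by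
    have : s ^ 2 ≤ Real.cos (θ / 2) ^ 2 := pow_le_pow_left₀ hs.1 hs.2 2
    rw [← h2] at this
    have hpos : 0 < 1 + Real.tan (θ / 2) ^ 2 := by positivity
    calc _ ≤ (1 + Real.tan (θ / 2) ^ 2)⁻¹ * (1 + Real.tan (θ / 2) ^ 2) :=
          mul_le_mul_of_nonneg_right this hpos.le
      _ = 1 := inv_mul_cancel₀ hpos.ne'
  nlinarith

theorem projQuantile_lt_cos_of_lt_threshold {q : ℕ} (hq : 1 ≤ q) {t : ℝ} (ht : t ∈ Ioo (0 : ℝ) 1) {θ : ℝ}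
    (hθ : θ ∈ Icc 0 Real.pi) (h : θ < thresholdAngle q t) :
    projQuantile q (1 - tMin t) < Real.cos (θ / 2) := by
  rw [← cos_thresholdAngle_half hq ht]
  exact Real.cos_lt_cos_of_nonneg_of_le_pi (by linarith [hθ.1])
    (by linarith [thresholdAngle_le_pi hq ht, Real.pi_pos]) (by linarith)

/-- For q = 3 the factor √(1 - s²) of the density cancels the denominator inside the affine function
F_2; this integrand is what remains, with τ = tan(θ/2). -/
theorem integral_slope_three {τ c : ℝ} (hc : c ∈ Ico (0 : ℝ) 1) :
    ∫ s in (0 : ℝ)..c, (√(1 - s ^ 2) + s * τ) = (c * √(1 - c ^ 2) + Real.arcsin c + τ * c ^ 2) / 2 := by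
  rw [intervalIntegral.integral_eq_sub_of_hasDerivAt
    (f := fun s => (s * √(1 - s ^ 2) + Real.arcsin s + τ * s ^ 2) / 2)]
  · simp
  · intro s hs
    rw [uIcc_of_le hc.1] at hs
    have hs1 : s < 1 := hs.2.trans_lt hc.2
    have h0 : 0 < 1 - s ^ 2 := by nlinarith [hs.1]
    have hw : 0 < √(1 - s ^ 2) := Real.sqrt_pos.2 h0
    have hsq : √(1 - s ^ 2) ^ 2 = 1 - s ^ 2 := Real.sq_sqrt h0.le
    have h1 : HasDerivAt (fun s : ℝ => 1 - s ^ 2) (-(2 * s)) s := by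
      simpa using ((hasDerivAt_id s).pow 2).const_sub 1
    have h2 := ((((hasDerivAt_id s).mul (h1.sqrt h0.ne')).add
      (Real.hasDerivAt_arcsin (by linarith [hs.1]) hs1.ne)).add
      (((hasDerivAt_id s).pow 2).const_mul τ)).div_const 2
    refine h2.congr_deriv ?_
    set w := √(1 - s ^ 2)
    simp only [id]
    push_cast
    field_simp
    ring_nf
    linarith
  · exact Continuous.intervalIntegrable (by fun_prop) _ _

theorem projKernel_three {t : ℝ} (ht : t ∈ Ioo (0 : ℝ) 1) {θ : ℝ} (hθ : θ ∈ Icc 0 Real.pi)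
    (h : θ < thresholdAngle 3 t) :
    projKernel 3 (rothmanWeight t) θ = 1 / 2 + tMin t - (θ + thresholdAngle 3 t) / (2 * Real.pi)
      + 1 / Real.pi * (Real.sin (thresholdAngle 3 t) / 2
        + Real.tan (θ / 2) * Real.cos (thresholdAngle 3 t / 2) ^ 2) := by
  have hpi := Real.pi_pos
  have hq : 1 ≤ 3 := by norm_num
  have hc := projQuantile_one_sub_tMin_mem hq ht
  have hcθ := projQuantile_lt_cos_of_lt_threshold hq ht hθ h
  have hth : thresholdAngle 3 t / 2 = Real.arccos (projQuantile 3 (1 - tMin t)) := by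
    rw [thresholdAngle, mul_div_cancel_left₀ _ two_ne_zero]
  have hcos := cos_thresholdAngle_half hq ht
  have hsin : Real.sin (thresholdAngle 3 t) = 2 * (projQuantile 3 (1 - tMin t) *
      √(1 - projQuantile 3 (1 - tMin t) ^ 2)) := by
    conv_lhs => rw [← mul_div_cancel₀ (thresholdAngle 3 t) two_ne_zero, Real.sin_two_mul, hcos, hth,
      Real.sin_arccos]
    ring
  have hasin : Real.arcsin (projQuantile 3 (1 - tMin t)) = Real.pi / 2 - thresholdAngle 3 t / 2 := by
    rw [hth, Real.arccos]; ring
  have hint : ∫ s in (0 : ℝ)..(projQuantile 3 (1 - tMin t)),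
      projCdf (3 - 1) (s * Real.tan (θ / 2) / √(1 - s ^ 2)) * projDensity 3 s =
      1 / Real.pi * ∫ s in (0 : ℝ)..(projQuantile 3 (1 - tMin t)), (√(1 - s ^ 2) + s * Real.tan (θ / 2)) := by
    rw [← intervalIntegral.integral_const_mul]
    refine intervalIntegral.integral_congr fun s hs => ?_
    rw [uIcc_of_le hc.1] at hs
    have hs1 : s < 1 := hs.2.trans_lt hc.2
    have hw : 0 < √(1 - s ^ 2) := Real.sqrt_pos.2 (by nlinarith [hs.1])
    have hm := slope_mem ⟨hθ.1, h.trans_le (thresholdAngle_le_pi hq ht)⟩ ⟨hs.1, hs.2.trans hcθ.le⟩ hs1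
    simp only [Nat.reduceSub]
    rw [projCdf_two_eq ⟨by linarith [hm.1], hm.2⟩, projDensity_three]
    field_simp
  rw [projKernel_of_lt_threshold (by norm_num) ht hθ h, hcos, hint, integral_slope_three hc, hsin, hasin]
  field_simp
  ring

/-- Integration by parts of the arccosine, with k = cos(θ/2) and σ = sin(θ/2), leaves the integral
of s σ/((1 - s²) √(k² - s²)). The substitution y = √(k² - s²), for which 1 - s² = σ² + y², turns it
into -arctan(y/σ). -/
theorem hasDerivAt_arccos_slope_primitive {θ s : ℝ} (hθ : θ ∈ Ioo 0 Real.pi)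
    (hs : s ∈ Ico 0 (Real.cos (θ / 2))) :
    HasDerivAt (fun s => s * Real.arccos (s / √(1 - s ^ 2) * Real.tan (θ / 2)) -
      Real.arctan (√(Real.cos (θ / 2) ^ 2 - s ^ 2) / Real.sin (θ / 2)))
      (Real.arccos (s / √(1 - s ^ 2) * Real.tan (θ / 2))) s := by
  set k := Real.cos (θ / 2) with hk
  set σ := Real.sin (θ / 2) with hσ
  have hk0 : 0 < k := Real.cos_pos_of_mem_Ioo ⟨by linarith [hθ.1, Real.pi_pos], by linarith [hθ.2]⟩
  have hσ0 : 0 < σ := Real.sin_pos_of_pos_of_lt_pi (by linarith [hθ.1]) (by linarith [hθ.2, Real.pi_pos])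
  have hkσ : σ ^ 2 + k ^ 2 = 1 := Real.sin_sq_add_cos_sq _
  have hy0 : 0 < k ^ 2 - s ^ 2 := by nlinarith [hs.1, hs.2]
  have h0 : 0 < 1 - s ^ 2 := by nlinarith
  have hs1 : s ∈ Ioo (-1 : ℝ) 1 := ⟨by linarith [hs.1], by nlinarith [hs.1]⟩
  have htan : Real.tan (θ / 2) = σ / k := Real.tan_eq_sin_div_cos _
  have hw := (hasDerivAt_div_sqrt_one_sub_sq hs1).mul_const (Real.tan (θ / 2))
  have hr : (1 - s ^ 2) ^ (-(3 / 2) : ℝ) = (√(1 - s ^ 2) ^ 3)⁻¹ := by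
    rw [Real.rpow_neg h0.le, Real.sqrt_eq_rpow, ← Real.rpow_natCast _ 3, ← Real.rpow_mul h0.le]
    norm_num
  have hR0 : 0 < √(1 - s ^ 2) := Real.sqrt_pos.2 h0
  have hRsq : √(1 - s ^ 2) ^ 2 = 1 - s ^ 2 := Real.sq_sqrt h0.le
  have hY0 : 0 < √(k ^ 2 - s ^ 2) := Real.sqrt_pos.2 hy0
  have hYsq : √(k ^ 2 - s ^ 2) ^ 2 = k ^ 2 - s ^ 2 := Real.sq_sqrt hy0.le
  have hsqrt : 1 - (s / √(1 - s ^ 2) * Real.tan (θ / 2)) ^ 2 = (√(k ^ 2 - s ^ 2) / (k * √(1 - s ^ 2))) ^ 2 := by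
    rw [htan, div_pow, mul_pow, mul_pow, div_pow, div_pow, hRsq, hYsq]
    field_simp
    nlinarith
  have hlt : (s / √(1 - s ^ 2) * Real.tan (θ / 2)) ^ 2 < 1 := by
    have : 0 < (√(k ^ 2 - s ^ 2) / (k * √(1 - s ^ 2))) ^ 2 := by positivity
    linarith
  have hab := abs_lt.1 ((sq_lt_one_iff_abs_lt_one _).1 hlt)
  have hA := (Real.hasDerivAt_arccos hab.1.ne' hab.2.ne).comp s hw
  have h1 : HasDerivAt (fun s : ℝ => k ^ 2 - s ^ 2) (-(2 * s)) s := by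
    simpa using ((hasDerivAt_id s).pow 2).const_sub (k ^ 2)
  have hB := ((h1.sqrt hy0.ne').div_const σ).arctan
  refine (((hasDerivAt_id s).mul hA).sub hB).congr_deriv ?_
  rw [hsqrt, Real.sqrt_sq (by positivity), hr, htan]
  simp only [id, Function.comp_apply]
  have e1 : 1 + (√(k ^ 2 - s ^ 2) / σ) ^ 2 = √(1 - s ^ 2) ^ 2 / σ ^ 2 := by
    rw [div_pow, hYsq, hRsq]
    field_simp
    linarith
  rw [e1]
  field_simp
  ring

theorem projKernel_two {t : ℝ} (ht : t ∈ Ioo (0 : ℝ) 1) {θ : ℝ} (hθ : θ ∈ Icc 0 Real.pi)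
    (h : θ < thresholdAngle 2 t) :
    projKernel 2 (rothmanWeight t) θ = -tMin t + 1 / 2
      - (1 - 2 * tMin t) / Real.pi *
          Real.arccos ((1 / 2 - tMin t) * Real.tan (θ / 2) / √(tMin t * (1 - tMin t)))
      + 1 / Real.pi * (if θ = 0 then Real.pi / 2 else
          Real.arctan (√(Real.cos (θ / 2) ^ 2 - (1 - 2 * tMin t) ^ 2) / Real.sin (θ / 2))) := by
  have hpi := Real.pi_pos
  have hq : 1 ≤ 2 := one_le_two
  have h0 := tMin_pos ht
  have h1 := tMin_le_half t
  have hquant : projQuantile 2 (1 - tMin t) = 1 - 2 * tMin t := projQuantile_two_eq ⟨h0.le, by linarith⟩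
  have hc := projQuantile_one_sub_tMin_mem hq ht
  have hcθ := projQuantile_lt_cos_of_lt_threshold hq ht hθ h
  have hθπ : θ < Real.pi := h.trans_le (thresholdAngle_le_pi hq ht)
  rw [projKernel_of_lt_threshold le_rfl ht hθ h, cos_thresholdAngle_half hq ht]
  rw [hquant] at hc hcθ ⊢
  set c := 1 - 2 * tMin t with hcdef
  have hint : ∫ s in (0 : ℝ)..c, projCdf (2 - 1) (s * Real.tan (θ / 2) / √(1 - s ^ 2)) * projDensity 2 s =
      ∫ s in (0 : ℝ)..c, (1 / 2 - 1 / (2 * Real.pi) * Real.arccos (s / √(1 - s ^ 2) * Real.tan (θ / 2))) := by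
    refine intervalIntegral.integral_congr fun s hs => ?_
    rw [uIcc_of_le hc.1] at hs
    have hs1 : s < 1 := hs.2.trans_lt hc.2
    have hm := slope_mem ⟨hθ.1, hθπ⟩ ⟨hs.1, hs.2.trans hcθ.le⟩ hs1
    simp only [Nat.reduceSub]
    rw [projCdf_one_eq ⟨by linarith [hm.1], hm.2⟩, projDensity_two, div_mul_eq_mul_div]
    field_simp
  rw [hint]
  -- At θ = 0 the primitive degenerates, since sin(θ/2) = 0, but the integrand is constant; reading
  -- the arctangent as π/2 gives the right value.
  rcases eq_or_ne θ 0 with rfl | hne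
  · simp only [zero_div, Real.tan_zero, mul_zero, Real.arccos_zero, intervalIntegral.integral_const,
      smul_eq_mul, if_true, sub_zero]
    field_simp
    rw [hcdef]; ring
  have hθ0 : 0 < θ := lt_of_le_of_ne hθ.1 hne.symm
  have hσ0 : 0 < Real.sin (θ / 2) := Real.sin_pos_of_pos_of_lt_pi (by linarith) (by linarith)
  have hk0 : 0 < Real.cos (θ / 2) := Real.cos_pos_of_mem_Ioo ⟨by linarith, by linarith⟩
  have hcont : ContinuousOn (fun s => Real.arccos (s / √(1 - s ^ 2) * Real.tan (θ / 2))) (uIcc 0 c) := by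
    rw [uIcc_of_le hc.1]
    refine Real.continuous_arccos.comp_continuousOn (ContinuousOn.mul (ContinuousOn.div continuousOn_id
      (by fun_prop) fun s hs => ?_) continuousOn_const)
    exact (Real.sqrt_pos.2 (by nlinarith [hs.1, hs.2, hc.2])).ne'
  have hFTC := intervalIntegral.integral_eq_sub_of_hasDerivAt
    (fun s hs => hasDerivAt_arccos_slope_primitive ⟨hθ0, hθπ⟩
      (by rw [uIcc_of_le hc.1] at hs; exact ⟨hs.1, hs.2.trans_lt hcθ⟩)) hcont.intervalIntegrable
  -- The primitive at the lower limit; its θ/2 cancels the term -θ/(2π) of the general formula.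
  have hat : Real.arctan (√(Real.cos (θ / 2) ^ 2 - 0 ^ 2) / Real.sin (θ / 2)) = Real.pi / 2 - θ / 2 := by
    rw [zero_pow two_ne_zero, sub_zero, Real.sqrt_sq hk0.le, ← Real.sin_pi_div_two_sub,
      ← Real.cos_pi_div_two_sub (θ / 2), ← Real.tan_eq_sin_div_cos, Real.arctan_tan (by linarith) (by linarith)]
  have hwc : c / √(1 - c ^ 2) * Real.tan (θ / 2) =
      (1 / 2 - tMin t) * Real.tan (θ / 2) / √(tMin t * (1 - tMin t)) := by
    have e1 : 1 - c ^ 2 = 2 ^ 2 * (tMin t * (1 - tMin t)) := by rw [hcdef]; ring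
    have e2 : 0 < √(tMin t * (1 - tMin t)) := Real.sqrt_pos.2 (mul_pos h0 (by linarith))
    rw [e1, Real.sqrt_mul (by norm_num), Real.sqrt_sq zero_le_two, hcdef]
    field_simp
  rw [intervalIntegral.integral_sub intervalIntegrable_const (hcont.intervalIntegrable.const_mul _),
    intervalIntegral.integral_const_mul, hFTC, hat, zero_mul, if_neg hne, hwc,
    intervalIntegral.integral_const, smul_eq_mul]
  field_simp
  rw [hcdef]; ring

/-! ### The U-statistic form. -/

theorem projEcdf_eq_sum {q n : ℕ} (X : Fin n → Hypersphere q) (γ : Hypersphere q) (x : ℝ) :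
    projEcdf X γ x = (∑ i, {γ | dotSphere γ (X i) ≤ x}.indicator (1 : Hypersphere q → ℝ) γ) / n := by
  classical
  rw [projEcdf, Nat.card_eq_fintype_card, Fintype.card_subtype, Finset.card_filter]
  push_cast
  simp [indicator]

/-- The variance of the projected empirical cdf at a point. -/
theorem integral_projEcdf_sub_sq {q n : ℕ} (hq : 1 ≤ q) (hn : 1 ≤ n) (X : Fin n → Hypersphere q) (x : ℝ) :
    ∫ γ, (projEcdf X γ x - projCdf q x) ^ 2 ∂(uniformSphere q) =
      1 / (n : ℝ) ^ 2 * ∑ i, ∑ j, capOverlapAngle q (angleSphere (X i) (X j)) x - projCdf q x ^ 2 := by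
  have hn0 : (n : ℝ) ≠ 0 := by positivity
  set I : Fin n → Hypersphere q → ℝ := fun i => {γ | dotSphere γ (X i) ≤ x}.indicator 1
  have hm : ∀ i, MeasurableSet {γ : Hypersphere q | dotSphere γ (X i) ≤ x} := fun i =>
    measurable_dotSphere (X i) measurableSet_Iic
  have hI : ∀ i, ∫ γ, I i γ ∂(uniformSphere q) = projCdf q x := fun i => by
    rw [integral_indicator_one (hm i), uniformSphere_real_dotSphere_le hq]
  have hIi : ∀ i, Integrable (I i) (uniformSphere q) := fun i =>
    (integrable_const (1 : ℝ)).indicator (hm i)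
  have hprod : ∀ i j, (fun γ => I i γ * I j γ) =
      ({γ | dotSphere γ (X i) ≤ x} ∩ {γ | dotSphere γ (X j) ≤ x}).indicator 1 := fun i j => by
    rw [inter_indicator_one]; rfl
  have hII : ∀ i j, ∫ γ, I i γ * I j γ ∂(uniformSphere q) = capOverlapAngle q (angleSphere (X i) (X j)) x :=
    fun i j => by
      rw [hprod, integral_indicator_one ((hm i).inter (hm j)), ← capOverlap_eq_capOverlapAngle hq]
      rfl
  have hIIi : ∀ i j, Integrable (fun γ => I i γ * I j γ) (uniformSphere q) := fun i j => by
    rw [hprod]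
    exact (integrable_const (1 : ℝ)).indicator ((hm i).inter (hm j))
  have hexp : ∀ γ, (projEcdf X γ x - projCdf q x) ^ 2 = 1 / (n : ℝ) ^ 2 * ∑ i, ∑ j, I i γ * I j γ -
      2 * projCdf q x / n * ∑ i, I i γ + projCdf q x ^ 2 := fun γ => by
    rw [projEcdf_eq_sum, ← Finset.sum_mul_sum]
    field_simp
    ring
  simp_rw [hexp]
  have h1 : Integrable (fun γ => ∑ i, ∑ j, I i γ * I j γ) (uniformSphere q) :=
    integrable_finsetSum _ fun i _ => integrable_finsetSum _ fun j _ => hIIi i j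
  have h2 : Integrable (fun γ => ∑ i, I i γ) (uniformSphere q) := integrable_finsetSum _ fun i _ => hIi i
  have h3 : Integrable (fun γ => 1 / (n : ℝ) ^ 2 * ∑ i, ∑ j, I i γ * I j γ -
      2 * projCdf q x / n * ∑ i, I i γ) (uniformSphere q) := (h1.const_mul _).sub (h2.const_mul _)
  rw [integral_add h3 (integrable_const _),
    integral_sub (h1.const_mul _) (h2.const_mul _), integral_const_mul, integral_const_mul,
    integral_finsetSum _ fun i _ => hIi i,
    integral_finsetSum _ fun i _ => integrable_finsetSum _ fun j _ => hIIi i j]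
  simp_rw [integral_finsetSum _ fun j _ => hIIi _ j, hII, hI]
  simp
  field_simp
  ring

theorem integrable_projEcdf_sub_sq {q n : ℕ} (X : Fin n → Hypersphere q) (x a : ℝ) :
    Integrable (fun γ => (projEcdf X γ x - a) ^ 2) (uniformSphere q) := by
  have hm : Measurable fun γ => projEcdf X γ x := by
    simp_rw [projEcdf_eq_sum]
    exact (Finset.measurable_fun_sum _ fun i _ => measurable_one.indicator
      (measurable_dotSphere (X i) measurableSet_Iic)).div_const _
  refine Integrable.of_bound ((hm.sub_const _).pow_const 2).aestronglyMeasurable ((1 + |a|) ^ 2)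
    (Filter.Eventually.of_forall fun γ => ?_)
  rw [norm_pow, Real.norm_eq_abs]
  refine pow_le_pow_left₀ (abs_nonneg _) ((abs_sub _ _).trans (add_le_add_left ?_ _)) 2
  rw [projEcdf, abs_of_nonneg (by positivity)]
  refine div_le_one_of_le₀ ?_ (by positivity)
  have := Nat.card_le_card_of_injective (fun i : {i : Fin n // dotSphere γ (X i) ≤ x} => i.1)
    Subtype.val_injective
  rw [Nat.card_fin] at this
  exact_mod_cast this

theorem projStat_rothmanWeight {q n : ℕ} (hq : 1 ≤ q) {t : ℝ} (ht : t ∈ Ioo (0 : ℝ) 1)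
    (X : Fin n → Hypersphere q) :
    projStat (rothmanWeight t) X = n * (1 / 2 *
      ((∫ γ, (projEcdf X γ (-projQuantile q (1 - tMin t)) -
          projCdf q (-projQuantile q (1 - tMin t))) ^ 2 ∂(uniformSphere q)) +
        ∫ γ, (projEcdf X γ (projQuantile q (1 - tMin t)) -
          projCdf q (projQuantile q (1 - tMin t))) ^ 2 ∂(uniformSphere q))) := by
  rw [projStat]
  simp_rw [integral_projWeight_rothmanWeight hq ht]
  rw [integral_const_mul, integral_add (integrable_projEcdf_sub_sq X _ _) (integrable_projEcdf_sub_sq X _ _)]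

theorem capOverlapAngle_angleSphere_self {q : ℕ} (hq : 1 ≤ q) (u : Hypersphere q) (x : ℝ) :
    capOverlapAngle q (angleSphere u u) x = projCdf q x := by
  rw [← capOverlap_eq_capOverlapAngle hq, capOverlap, ← uniformSphere_real_dotSphere_le hq u]
  simp

theorem sum_sum_eq_sum_diag_add_two_mul {n : ℕ} (f : Fin n → Fin n → ℝ) (hf : ∀ i j, f i j = f j i) :
    ∑ i, ∑ j, f i j = ∑ i, f i i + 2 * ∑ i, ∑ j ∈ Finset.Ioi i, f i j := by
  have h := Finset.sum_sum_Ioi_add_eq_sum_sum_off_diag f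
  have h1 : ∀ i, ∑ j, f i j = f i i + ∑ j ∈ {i}ᶜ, f j i := fun i => by
    rw [← Finset.sum_add_sum_compl {i}, Finset.sum_singleton]
    exact congrArg _ (Finset.sum_congr rfl fun j _ => hf i j)
  simp_rw [h1, Finset.sum_add_distrib, ← h, Finset.mul_sum]
  congr 1
  refine Finset.sum_congr rfl fun i _ => Finset.sum_congr rfl fun j _ => ?_
  rw [hf j i]; ring

theorem angleSphere_comm {q : ℕ} (u v : Hypersphere q) : angleSphere u v = angleSphere v u := by
  rw [angleSphere, angleSphere, dotSphere_comm]

/-- Each diagonal pair contributes F_q(x). At the two atoms F_q is t_m and 1 - t_m: these sum to 1,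
and their squares sum to 1 - 2 t_m (1 - t_m), which accounts for the constants. -/
theorem projStat_eq_sum {q n : ℕ} (hq : 1 ≤ q) (hn : 1 ≤ n) {t : ℝ} (ht : t ∈ Ioo (0 : ℝ) 1)
    (X : Fin n → Hypersphere q) :
    projStat (rothmanWeight t) X = 2 / (n : ℝ) * ∑ i : Fin n, ∑ j ∈ Finset.Ioi i,
      projKernel q (rothmanWeight t) (angleSphere (X i) (X j)) + (1 - (n : ℝ)) / 2 + n * t * (1 - t) := by
  have hn0 : (n : ℝ) ≠ 0 := by positivity
  have hF : projCdf q (projQuantile q (1 - tMin t)) = 1 - tMin t :=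
    projCdf_projQuantile hq (one_sub_tMin_mem_unit ht)
  have hF' : projCdf q (-projQuantile q (1 - tMin t)) = tMin t := by
    rw [projCdf_neg hq (projQuantile_mem hq (one_sub_tMin_mem_unit ht)), hF]; ring
  have hs : ∀ x, ∑ i, ∑ j, capOverlapAngle q (angleSphere (X i) (X j)) x = n * projCdf q x +
      2 * ∑ i, ∑ j ∈ Finset.Ioi i, capOverlapAngle q (angleSphere (X i) (X j)) x := fun x => by
    rw [sum_sum_eq_sum_diag_add_two_mul _ fun i j => by rw [angleSphere_comm]]
    simp [capOverlapAngle_angleSphere_self hq]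
  simp_rw [projKernel, integral_projWeight_rothmanWeight hq ht, ← Finset.mul_sum, Finset.sum_add_distrib]
  rw [projStat_rothmanWeight hq ht, integral_projEcdf_sub_sq hq hn, integral_projEcdf_sub_sq hq hn,
    hs, hs, hF, hF', mul_assoc (n : ℝ) t, ← tMin_mul_one_sub t]
  field_simp
  ring

/-! ### Rothman's statistic on the circle. -/

/-- A(θ, x) - A(θ, -x) = 2F(x) - 1 does not depend on θ, and F(x)² - (1 - F(x))² is the same number.
Hence one of the two atoms determines the statistic. -/
theorem integral_projEcdf_sub_sq_neg {q n : ℕ} (hq : 1 ≤ q) (hn : 1 ≤ n) (X : Fin n → Hypersphere q)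
    {x : ℝ} (hx : x ∈ Icc (-1 : ℝ) 1) :
    ∫ γ, (projEcdf X γ (-x) - projCdf q (-x)) ^ 2 ∂(uniformSphere q) =
      ∫ γ, (projEcdf X γ x - projCdf q x) ^ 2 ∂(uniformSphere q) := by
  have hn0 : (n : ℝ) ≠ 0 := by positivity
  rw [integral_projEcdf_sub_sq hq hn, integral_projEcdf_sub_sq hq hn, projCdf_neg hq hx]
  simp_rw [capOverlapAngle_neg hq, capOverlapAngle_eq hq, Finset.sum_add_distrib]
  simp
  field_simp
  ring

theorem integral_uniformSphere_one {f : EuclideanSpace ℝ (Fin 2) → ℝ} (hf : Measurable f) (h0 : ∀ x, 0 ≤ f x) :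
    ∫ ξ, f ξ ∂(uniformSphere 1) = 1 / (2 * Real.pi) *
      ∫ α in (-Real.pi)..Real.pi, f !₂[Real.cos α, Real.sin α] := by
  have hpi := Real.pi_pos
  have hm : Measurable fun α : ℝ => f !₂[Real.cos α, Real.sin α] :=
    hf.comp (measurable_toLp_pair.comp (Real.measurable_cos.prodMk Real.measurable_sin))
  rw [intervalIntegral.integral_of_le (by linarith), integral_Ioc_eq_integral_Ioo,
    integral_eq_lintegral_of_nonneg_ae (Filter.Eventually.of_forall fun ξ => h0 _)
      (hf.comp measurable_subtype_coe).aestronglyMeasurable,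
    integral_eq_lintegral_of_nonneg_ae (Filter.Eventually.of_forall fun ξ => h0 _)
      hm.aestronglyMeasurable, lintegral_uniformSphere_one hf.ennreal_ofReal, ENNReal.toReal_mul,
    ENNReal.toReal_ofReal (by positivity)]

/-- Since arccos is decreasing, a point lies in the open arc exactly when its projection on the
midpoint direction is not at most cos(πt). -/
theorem arcCount_eq {n : ℕ} {t : ℝ} (ht : t ∈ Ioo (0 : ℝ) 1) (Θ : Fin n → ℝ) (α : ℝ) :
    (arcCount Θ α t : ℝ) =
      n - ∑ i, (Iic (Real.cos (Real.pi * t))).indicator (1 : ℝ → ℝ) (Real.cos (Θ i - (α + t * Real.pi))) := by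
  classical
  have hpi := Real.pi_pos
  have hn : (n : ℝ) = ∑ i : Fin n, (1 : ℝ) := by simp
  rw [arcCount, Nat.card_eq_fintype_card, Fintype.card_subtype, Finset.card_filter, hn,
    ← Finset.sum_sub_distrib]
  push_cast
  refine Finset.sum_congr rfl fun i _ => ?_
  set y := Real.cos (Θ i - (α + t * Real.pi))
  have hy : Real.arccos y < t * Real.pi ↔ ¬ y ≤ Real.cos (Real.pi * t) := by
    have h1 : t * Real.pi = Real.arccos (Real.cos (Real.pi * t)) := by
      rw [Real.arccos_cos (mul_nonneg hpi.le ht.1.le) (by nlinarith [ht.2]), mul_comm]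
    rw [h1, Real.strictAntiOn_arccos.lt_iff_gt ⟨Real.neg_one_le_cos _, Real.cos_le_one _⟩
      ⟨Real.neg_one_le_cos _, Real.cos_le_one _⟩, not_le]
  by_cases h : y ≤ Real.cos (Real.pi * t)
  · rw [if_neg (fun h' => hy.1 h' h), indicator_of_mem (mem_Iic.2 h)]; simp
  · rw [if_pos (hy.2 h), indicator_of_notMem (by simpa using h)]; simp

theorem projStat_eq_rothmanStat {n : ℕ} (hn : 1 ≤ n) {t : ℝ} (ht : t ∈ Ioo (0 : ℝ) 1) (Θ : Fin n → ℝ)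
    (X : Fin n → Hypersphere 1)
    (hX : ∀ i, (X i : EuclideanSpace ℝ (Fin 2)) = !₂[Real.cos (Θ i), Real.sin (Θ i)]) :
    projStat (rothmanWeight t) X = rothmanStat Θ t := by
  have hpi := Real.pi_pos
  have hn0 : (n : ℝ) ≠ 0 := by positivity
  set x := Real.cos (Real.pi * t) with hx
  have hxm : x ∈ Icc (-1 : ℝ) 1 := ⟨Real.neg_one_le_cos _, Real.cos_le_one _⟩
  have hFx : projCdf 1 x = 1 - t := by
    rw [projCdf_one_eq hxm, Real.arccos_cos (mul_nonneg hpi.le ht.1.le) (by nlinarith [ht.2])]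
    field_simp
  -- According to whether t_m is t or 1 - t, the quantile cos(π t_m) is cos(πt) or its negative.
  have hc : projQuantile 1 (1 - tMin t) = x ∨ projQuantile 1 (1 - tMin t) = -x := by
    rw [projQuantile_one_eq ⟨(tMin_pos ht).le, by linarith [tMin_le_half t]⟩]
    rcases min_choice t (1 - t) with h | h <;> rw [tMin, h]
    · exact Or.inl rfl
    · right; rw [hx, ← Real.cos_pi_sub]; congr 1; ring
  have h1 : projStat (rothmanWeight t) X =
      n * ∫ γ, (projEcdf X γ x - projCdf 1 x) ^ 2 ∂(uniformSphere 1) := by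
    rw [projStat_rothmanWeight le_rfl ht]
    rcases hc with h | h <;> rw [h]
    · rw [integral_projEcdf_sub_sq_neg le_rfl hn X hxm]; ring
    · rw [neg_neg, integral_projEcdf_sub_sq_neg le_rfl hn X hxm]; ring
  set f : EuclideanSpace ℝ (Fin 2) → ℝ := fun y =>
    ((∑ i, (Iic x).indicator (1 : ℝ → ℝ) (inner ℝ y (X i : EuclideanSpace ℝ (Fin 2)))) / n - (1 - t)) ^ 2 with hf
  have hfm : Measurable f :=
    ((Finset.measurable_fun_sum _ fun i _ => (measurable_one.indicator measurableSet_Iic).comp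
      (by fun_prop)).div_const _ |>.sub_const _).pow_const 2
  have h2 : ∀ γ : Hypersphere 1, (projEcdf X γ x - projCdf 1 x) ^ 2 = f γ := fun γ => by
    rw [projEcdf_eq_sum, hFx]; rfl
  set g : ℝ → ℝ := fun β => f !₂[Real.cos β, Real.sin β] with hg
  have hgp : Function.Periodic g (2 * Real.pi) := fun β => by simp [hg]
  have h3 : ∀ α, ((arcCount Θ α t : ℝ) - n * t) ^ 2 = n ^ 2 * g (α + t * Real.pi) := fun α => by
    have e : ∀ i, inner ℝ (!₂[Real.cos (α + t * Real.pi), Real.sin (α + t * Real.pi)] : EuclideanSpace ℝ (Fin 2))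
        (X i : EuclideanSpace ℝ (Fin 2)) = Real.cos (Θ i - (α + t * Real.pi)) := fun i => by
      rw [hX, Real.cos_sub]
      simp [PiLp.inner_apply, Fin.sum_univ_two]
    simp only [hg, hf, e]
    rw [arcCount_eq ht]
    field_simp
    ring
  -- Periodicity absorbs the shift by tπ from the midpoint of the arc and moves the period to [-π,
  -- π].
  have h4 := hgp.intervalIntegral_add_eq (t * Real.pi) (-Real.pi)
  rw [h1]
  simp_rw [h2]
  rw [integral_uniformSphere_one hfm fun y => sq_nonneg _, rothmanStat]
  simp_rw [h3]
  rw [intervalIntegral.integral_const_mul, intervalIntegral.integral_comp_add_right g, zero_add,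
    add_comm (2 * Real.pi), h4, show -Real.pi + 2 * Real.pi = Real.pi by ring]
  field_simp
  rfl

end

theorem mainTheorem8 (t : ℝ) (ht : t ∈ Set.Ioo (0 : ℝ) 1) :
    -- the intersection proportion depends on the pair of points only through their angle
    (∀ q : ℕ, 1 ≤ q → ∀ (u v : Hypersphere q) (x : ℝ),
      capOverlap u v x = capOverlapAngle q (angleSphere u v) x) ∧
    -- the U-statistic form
    (∀ q : ℕ, 1 ≤ q → ∀ n : ℕ, 1 ≤ n → ∀ X : Fin n → Hypersphere q,
      projStat (rothmanWeight t) X =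
        2 / (n : ℝ) * ∑ i : Fin n, ∑ j ∈ Finset.Ioi i,
            projKernel q (rothmanWeight t) (angleSphere (X i) (X j))
          + (1 - (n : ℝ)) / 2 + n * t * (1 - t)) ∧
    -- the kernel for q = 1
    (∀ θ ∈ Set.Icc (0 : ℝ) Real.pi,
      projKernel 1 (rothmanWeight t) θ = rothmanH t θ + 1 / 2 - t * (1 - t)) ∧
    -- the kernel for q = 2; the arctangent is read as π/2 at θ = 0
    (∀ θ ∈ Set.Icc (0 : ℝ) Real.pi,
      projKernel 2 (rothmanWeight t) θ =
        if θ < thresholdAngle 2 t then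
          -tMin t + 1 / 2
            - (1 - 2 * tMin t) / Real.pi *
                Real.arccos ((1 / 2 - tMin t) * Real.tan (θ / 2) /
                  Real.sqrt (tMin t * (1 - tMin t)))
            + 1 / Real.pi *
                (if θ = 0 then Real.pi / 2 else
                  Real.arctan (Real.sqrt (Real.cos (θ / 2) ^ 2 - (1 - 2 * tMin t) ^ 2) /
                    Real.sin (θ / 2)))
        else 1 / 2 - tMin t) ∧
    -- the kernel for q = 3
    (∀ θ ∈ Set.Icc (0 : ℝ) Real.pi,
      projKernel 3 (rothmanWeight t) θ =
        if θ < thresholdAngle 3 t then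
          1 / 2 + tMin t - (θ + thresholdAngle 3 t) / (2 * Real.pi)
            + 1 / Real.pi * (Real.sin (thresholdAngle 3 t) / 2
                + Real.tan (θ / 2) * Real.cos (thresholdAngle 3 t / 2) ^ 2)
        else 1 / 2 - tMin t) ∧
    -- the kernel for q ≥ 2, with dF_q(s) = projDensity q s ds
    (∀ q : ℕ, 2 ≤ q → ∀ θ ∈ Set.Icc (0 : ℝ) Real.pi,
      projKernel q (rothmanWeight t) θ =
        if θ < thresholdAngle q t then
          tMin t - θ / (2 * Real.pi)
            + 2 * ∫ s in (0 : ℝ)..(Real.cos (thresholdAngle q t / 2)),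
                projCdf (q - 1) (s * Real.tan (θ / 2) / Real.sqrt (1 - s ^ 2))
                  * projDensity q s
        else 1 / 2 - tMin t) ∧
    -- for q = 1 the statistic is Rothman's
    (∀ n : ℕ, 1 ≤ n → ∀ (Θ : Fin n → ℝ) (X : Fin n → Hypersphere 1),
      (∀ i, (X i : EuclideanSpace ℝ (Fin 2)) = !₂[Real.cos (Θ i), Real.sin (Θ i)]) →
      projStat (rothmanWeight t) X = rothmanStat Θ t) := by
  refine ⟨fun q hq u v x => capOverlap_eq_capOverlapAngle hq u v x,
    fun q hq n hn X => projStat_eq_sum hq hn ht X, fun θ hθ => projKernel_one ht hθ,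
    fun θ hθ => ?_, fun θ hθ => ?_, fun q hq θ hθ => ?_,
    fun n hn Θ X hX => projStat_eq_rothmanStat hn ht Θ X hX⟩
  · split_ifs with h h0
    · rw [projKernel_two ht hθ h, if_pos h0]
    · rw [projKernel_two ht hθ h, if_neg h0]
    · exact projKernel_of_threshold_le one_le_two ht hθ (not_lt.1 h)
  · split_ifs with h
    · exact projKernel_three ht hθ h
    · exact projKernel_of_threshold_le (by norm_num) ht hθ (not_lt.1 h)
  · split_ifs with h
    · exact projKernel_of_lt_threshold hq ht hθ h
    · exact projKernel_of_threshold_le (by omega) ht hθ (not_lt.1 h)
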